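/- Let $\mathbb{B}_1,\mathbb{B}_2\subset\mathbb{R}^3$ be two closed balls of the same radius $r>0$ with centers $A_1\neq A_2$, $|A_1A_2|<2r$, and let $C=\partial\mathbb{B}_1\cap\partial\mathbb{B}_2$ be their intersection circle. Let $B$ be a (closed or open) ball of $\mathbb{R}^3$, let $\alpha=\arcsin\left(\frac{|A_1A_2|}{2r}\right)$, and let $\beta=2\pi\,\frac{\mathrm{length}(B\cap C)}{\mathrm{length}(C)}$ be the angle of the arc $B\cap C$. Let $(O,i,j,k)$ be an orthonormal frame whose origin $O$ is the center of $C$, such that $(O,i,j)$ spans the plane of $C$, $i$ points toward an extremity of the arc $B\cap C$, and the arc is swept from $i$ toward $j$: $O+r\cos\alpha\,(\cos u\; i+\sin u\; j)\in B\cap C$ for all $0<u<\beta$. *Definitions.* On $T\mathbb{R}^3=\mathbb{R}^3\times\mathbb{R}^3$ with the product scalar product put $u^*=\langle u,\cdot\rangle$, and at $(m,\xi)$ $$\omega^{X,Y}=(0,Y)^*\wedge(\xi\times X,0)^*,\qquad \widetilde\omega^{X,Y}=(X,0)^*\wedge(0,\xi\times Y)^*.$$ For a convex body $K$, the normal cycle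 $N(K)$ is the $2$-current of integration, with respect to the $2$-dimensional Hausdorff measure, over the unit normal bundle $\{(p,n): p\in\partial K,\ \|n\|=1,\ \langle n,x-p\rangle\le 0\ \ \forall x\in K\}$, oriented by the outer normal: a tangent basis $(\tau_0,\tau_1)$ at $(p,n)$ is direct if its image under $(p,n)\mapsto p+tn$ followed by $n$ is a direct basis of $\mathbb{R}^3$ for every $t>0$. For a finite union of convex bodies it is extended by inclusion–exclusion, so $N(\mathbb{B}_1\cup\mathbb{B}_2)=N(\mathbb{B}_1)+N(\mathbb{B}_2)-N(\mathbb{B}_1\cap\mathbb{B}_2)$. The anisotropic curvature measures of $V=\mathbb{B}_1\cup\mathbb{B}_2$ above a Borel set $A$ are the bilinear forms $$\overline H_V(A)(X,Y)=N(V)\left(\mathbf 1_{A\times\mathbb{R}^3}\,\omega^{X,Y}\right),\qquad \overline{\widetilde H}_V(A)(X,Y)=N(V)\left(\mathbf 1_{A\times\mathbb{R}^3}\,\widetilde\omega^{X,Y}\right).$$ *Claim.* All integrals defining these forms for $A=B\cap C$ converge absolutely, and in the frame $(i,j,k)$ the forms are given by the matrices $$\overline H_{\mathbb{B}_1\cup\mathbb{B}_2}(B\cap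 C)=-r\cos\alpha\begin{pmatrix}\frac12\left(\alpha-\frac{\sin2\alpha}2\right)\left(\beta+\frac{\sin2\beta}2\right)&\left(\alpha-\frac{\sin2\alpha}2\right)\frac{1-\cos2\beta}4&0\\ \left(\alpha-\frac{\sin2\alpha}2\right)\frac{1-\cos2\beta}4&\frac12\left(\alpha-\frac{\sin2\alpha}2\right)\left(\beta-\frac{\sin2\beta}2\right)&0\\0&0&\beta\left(\alpha+\frac{\sin2\alpha}2\right)\end{pmatrix},$$ $$\overline{\widetilde H}_{\mathbb{B}_1\cup\mathbb{B}_2}(B\cap C)=-r\,\alpha\cos\alpha\begin{pmatrix}\beta-\frac{\sin2\beta}2&\frac{\cos2\beta-1}2&0\\ \frac{\cos2\beta-1}2&\beta+\frac{\sin2\beta}2&0\\0&0&0\end{pmatrix}.$$ -/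

import Mathlib

open MeasureTheory

noncomputable section

namespace AnisotropicCurvature

/-- Euclidean space `ℝ³`; it serves both as the base space `E` and as the fibre `F`. -/
abbrev Space : Type := EuclideanSpace ℝ (Fin 3)

/-- `Tℝ³ = E × F` with the dot product `⟨(e, f), (e', f')⟩ = ⟨e, e'⟩ + ⟨f, f'⟩`. -/
abbrev Total : Type := WithLp 2 (Space × Space)

/-- The cross product of `ℝ³`. -/
def cross (x y : Space) : Space := WithLp.toLp 2 (crossProduct x.ofLp y.ofLp)

/-- Alternating `2`-forms on the vector space `E × F`. -/
abbrev TwoForm : Type := Total [⋀^Fin 2]→ₗ[ℝ] ℝ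

/-- `u* ∧ v*`, where `u* x = ⟨u, x⟩`: its value on `(x₀, x₁)` is
`u* x₀ * v* x₁ - v* x₀ * u* x₁`. -/
def wedge (u v : Total) : TwoForm :=
  (Matrix.detRowAlternating (n := Fin 2) (R := ℝ)).compLinearMap
    (LinearMap.pi ![innerₗ Total u, innerₗ Total v])

theorem wedge_apply (u v : Total) (x : Fin 2 → Total) :
    wedge u v x = inner ℝ u (x 0) * inner ℝ v (x 1) - inner ℝ v (x 0) * inner ℝ u (x 1) := by
  have h : wedge u v x = Matrix.det
      (Matrix.of fun i j => (![innerₗ Total u, innerₗ Total v] : Fin 2 → Total →ₗ[ℝ] ℝ) j (x i)) :=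
    rfl
  rw [h, Matrix.det_fin_two]
  simp

/-! ### Normal cycles -/

/-- The normal cone of a convex set `K` at `p`: the unit vectors `n` with `n · px ≤ 0` for all
`x ∈ K`. -/
def normalCone (K : Set Space) (p : Space) : Set Space :=
  {n | ‖n‖ = 1 ∧ ∀ x ∈ K, inner ℝ n (x - p) ≤ 0}

/-- The unit normal bundle `{(p, n) | p ∈ ∂K, n in the normal cone of K at p}` of a convex set. -/
def normalBundle (K : Set Space) : Set Total :=
  {a | a.fst ∈ frontier K ∧ a.snd ∈ normalCone K a.fst}

/-- `(τ 0, τ 1)` is a direct orthonormal basis of the tangent plane of the unit normal bundle of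
`K` at `a = (p, n)`. The plane is oriented by the outer normal: pushing the basis forward by
`(p, n) ↦ p + t n` for `t > 0` gives vectors `w₀, w₁` such that `(w₀, w₁, n)` is direct. -/
structure IsDirectTangentFrame (K : Set Space) (a : Total) (τ : Fin 2 → Total) : Prop where
  orthonormal : Orthonormal ℝ τ
  span_eq : (Submodule.span ℝ (Set.range τ) : Set Total) = tangentConeAt ℝ (normalBundle K) a
  direct : ∀ t : ℝ, 0 < t →
    0 < inner ℝ
      (cross ((τ 0).fst + t • (τ 0).snd) ((τ 1).fst + t • (τ 1).snd)) a.snd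

open Classical in
/-- The pairing `⟨S⃗(a), φ⟩` of a `2`-form with the unit `2`-vector `S⃗(a) = τ₀ ∧ τ₁` that orients
the unit normal bundle of `K` at `a`. Two direct orthonormal bases of the tangent plane have the
same exterior product, so the choice of the basis is immaterial. The value `0` is used at the
points without oriented tangent plane. -/
def orientedPairing (K : Set Space) (a : Total) (φ : TwoForm) : ℝ :=
  if h : ∃ τ, IsDirectTangentFrame K a τ then φ h.choose else 0

/-- The set `A × F` of all points of `E × F` above `A`. -/
def above (A : Set Space) : Set Total := {a | a.fst ∈ A}

/-- `N(K) ⌞ (A × F)` applied to the form `φ`, where `N(K)` is the current of integration, with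
respect to the two-dimensional Hausdorff measure, over the oriented unit normal bundle of a convex
set `K`. -/
def convexNormalCycle (K A : Set Space) (φ : Total → TwoForm) : ℝ :=
  ∫ a in normalBundle K ∩ above A, orientedPairing K a (φ a) ∂μHE[2]

/-- `N(𝒞) ⌞ (A × F)` applied to the form `φ`, for the union `𝒞 = ⋃ i, K i` of a finite family of
convex sets; the normal cycle is extended to unions by inclusion-exclusion. -/
def unionNormalCycle {ι : Type*} [Fintype ι] (K : ι → Set Space) (A : Set Space)
    (φ : Total → TwoForm) : ℝ :=
  ∑ s : Finset ι with s.Nonempty, (-1 : ℝ) ^ (s.card + 1) * convexNormalCycle (⋂ i ∈ s, K i) A φ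

/-- All the integrals in the definition of `unionNormalCycle K A φ` converge absolutely. -/
def UnionNormalCycleConverges {ι : Type*} (K : ι → Set Space) (A : Set Space)
    (φ : Total → TwoForm) : Prop :=
  ∀ s : Finset ι, s.Nonempty →
    IntegrableOn (fun a => orientedPairing (⋂ i ∈ s, K i) a (φ a))
      (normalBundle (⋂ i ∈ s, K i) ∩ above A) μHE[2]

/-! ### Anisotropic curvature measures -/

/-- The form `ω^{X,Y}`, given at `(m, ξ)` by `(0, Y)* ∧ (ξ × X, 0)*`. -/
def omegaForm (X Y : Space) (a : Total) : TwoForm :=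
  wedge (WithLp.toLp 2 (0, Y)) (WithLp.toLp 2 (cross a.snd X, 0))

/-- The form `ω̃^{X,Y}`, given at `(m, ξ)` by `(X, 0)* ∧ (0, ξ × Y)*`. -/
def omegaTildeForm (X Y : Space) (a : Total) : TwoForm :=
  wedge (WithLp.toLp 2 (X, 0)) (WithLp.toLp 2 (0, cross a.snd Y))

/-- The anisotropic curvature measure `H̄(A)(X, Y)` of the union of a finite family of convex
sets. -/
def anisoH {ι : Type*} [Fintype ι] (K : ι → Set Space) (A : Set Space) (X Y : Space) : ℝ :=
  unionNormalCycle K A (omegaForm X Y)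

/-- The second anisotropic curvature measure of the union of a finite family of convex sets,
defined with `ω̃^{X,Y}` in place of `ω^{X,Y}`. -/
def anisoHTilde {ι : Type*} [Fintype ι] (K : ι → Set Space) (A : Set Space) (X Y : Space) : ℝ :=
  unionNormalCycle K A (omegaTildeForm X Y)

/-- The bilinear form whose matrix in the orthonormal frame `b` is `M`. -/
def formOfMatrix (b : OrthonormalBasis (Fin 3) ℝ Space) (M : Matrix (Fin 3) (Fin 3) ℝ)
    (X Y : Space) : ℝ :=
  ∑ p, ∑ q, inner ℝ (b p) X * M p q * inner ℝ (b q) Y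

end AnisotropicCurvature

end

open AnisotropicCurvature

/-! Above a subset of the circle `C`, the unit normal bundle of a single ball consists of pairs `(p,
(p - A) / r)` with `p` on `C`. It lies on a smooth curve, which is null for two-dimensional
Hausdorff measure. By inclusion-exclusion only the intersection of the two balls contributes, with a
minus sign: this is the sign of both matrices (`unionNormalCycle_closedBalls`).

The intersection is a lens with edge `C`, of radius `ρ = r cos α`. Over the edge point of angle `u`,
the unit normals are the vectors of latitude `θ ∈ [-α, α]` in the half plane of the radial vector
and the axis (`mem_normalCone_lens_iff`). Hence `(u, θ)` parametrizes the relevant part of the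
bundle. The two partial derivatives are orthogonal, and their span is the tangent plane when `|θ| <
α`. This needs two inclusions, since the plane is defined as the tangent cone of the whole bundle:
the image of the derivative lies in the cone, and the equations of the bundle bound the cone from
above (`isDirectTangentFrame_lensFrame`).

By the area formula (`integral_image_eq_integral_normDet_mul`) the normal cycle becomes an integral
over parameters. The Jacobian cancels the normalization of the tangent frame, so the integrand is
the form evaluated on the two partial derivatives (`convexNormalCycle_lens`). With `t` the unit
tangent of the circle and `e` the derivative of the normal in `θ`, this is `ρ⟨e, X⟩⟨e, Y⟩` for `ω`
and `ρ⟨t, X⟩⟨t, Y⟩` for `ω̃`. Integration over `[0, β] × [-α, α]` gives the matrices. The parameter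
set of `B ∩ C` is `(0, β)` up to a null set because it contains this interval and has the same
length. -/

noncomputable section

namespace AnisotropicCurvature
open Set Filter Topology Module
open scoped NNReal ENNReal

/-! ### The area formula for immersions -/

section AreaFormula

/-- Comparison of Hausdorff measures of images under two maps, one of which expands distances at
most `K` times more than the other. -/
theorem hausdorffMeasure_image_le_of_dist_le {T X Y : Type*} [MetricSpace X] [MeasurableSpace X]
    [BorelSpace X] [MetricSpace Y] [MeasurableSpace Y] [BorelSpace Y] {f : T → X} {g : T → Y}
    {s : Set T} {K : ℝ≥0} (h : ∀ y ∈ s, ∀ z ∈ s, dist (f y) (f z) ≤ K * dist (g y) (g z)) (d : ℕ) :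
    μHE[d] (f '' s) ≤ (K : ℝ≥0∞) ^ d * μHE[d] (g '' s) := by
  rcases s.eq_empty_or_nonempty with rfl | ⟨x₀, hx₀⟩
  · simp
  have : Nonempty T := ⟨x₀⟩
  have hinv : ∀ y ∈ s, Function.invFunOn g s (g y) ∈ s ∧ g (Function.invFunOn g s (g y)) = g y :=
    fun y hy => ⟨Function.invFunOn_mem ⟨y, hy, rfl⟩, Function.invFunOn_eq ⟨y, hy, rfl⟩⟩
  -- Points with the same image under `g` have the same image under `f`, so `f` factors through `g`
  -- on `s`, and the factor is `K`-Lipschitz.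
  have hfi : ∀ y ∈ s, f (Function.invFunOn g s (g y)) = f y := by
    intro y hy
    have := h _ (hinv y hy).1 y hy
    rw [(hinv y hy).2, dist_self, mul_zero] at this
    exact dist_le_zero.1 this
  have hL : LipschitzOnWith K (fun w => f (Function.invFunOn g s w)) (g '' s) := by
    refine LipschitzOnWith.of_dist_le_mul ?_
    rintro _ ⟨y, hy, rfl⟩ _ ⟨z, hz, rfl⟩
    simp only [hfi y hy, hfi z hz]
    exact h y hy z hz
  have himg : (fun w => f (Function.invFunOn g s w)) '' (g '' s) = f '' s := by
    rw [image_image]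
    exact image_congr hfi
  have := hL.hausdorffMeasure_image_le (d := d) (Nat.cast_nonneg d)
  rw [himg, ENNReal.rpow_natCast] at this
  simp only [Measure.euclideanHausdorffMeasure_def, Measure.smul_apply, ENNReal.smul_def,
    smul_eq_mul]
  rw [mul_left_comm]
  gcongr

variable {U V : Type*} [NormedAddCommGroup U] [InnerProductSpace ℝ U] [FiniteDimensional ℝ U]
  [NormedAddCommGroup V] [InnerProductSpace ℝ V]

/-- Near a point of strict differentiability with injective derivative, a map is close to its
derivative in the bi-Lipschitz sense. -/
theorem eventually_dist_le_of_hasStrictFDerivAt {f : U → V} {f' : U →L[ℝ] V} {x : U}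
    (hf : HasStrictFDerivAt f f' x) (hinj : Function.Injective f') {c : ℝ} (hc : 1 < c) :
    ∃ W ∈ 𝓝 x, ∀ y ∈ W, ∀ z ∈ W, dist (f y) (f z) ≤ c * dist (f' y) (f' z) ∧
      dist (f' y) (f' z) ≤ c * dist (f y) (f z) := by
  obtain ⟨K, hK, hKf⟩ := f'.toLinearMap.exists_antilipschitzWith (LinearMap.ker_eq_bot.2 hinj)
  have hc0 : 0 < c := by linarith
  have hη : 0 < 1 - 1 / c := by
    rw [sub_pos, div_lt_one hc0]; exact hc
  have hK' : (0 : ℝ) < K := hK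
  -- Since `f'` shrinks distances by at most `K`, an error `(1 - 1/c)/K * ‖y - z‖` is at most the
  -- fraction `1 - 1/c` of `‖f' (y - z)‖`.
  obtain ⟨W, hW, hWf⟩ := (hf.approximates_deriv_on_nhds
    (c := ⟨(1 - 1 / c) / K, by positivity⟩) (Or.inr (NNReal.coe_pos.1 (div_pos hη hK'))))
  refine ⟨W, hW, fun y hy z hz => ?_⟩
  have h1 := hWf y hy z hz
  have h2 : ‖y - z‖ ≤ K * ‖f' (y - z)‖ := by
    have := hKf.le_mul_dist y z
    simpa [dist_eq_norm, ← map_sub] using this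
  have h3 : ‖f y - f z - f' (y - z)‖ ≤ (1 - 1 / c) * ‖f' (y - z)‖ := by
    refine h1.trans ?_
    calc (1 - 1 / c) / K * ‖y - z‖ ≤ (1 - 1 / c) / K * (K * ‖f' (y - z)‖) := by gcongr
      _ = _ := by field_simp
  rw [dist_eq_norm, dist_eq_norm, ← map_sub]
  have h4 : ‖f y - f z‖ ≤ ‖f y - f z - f' (y - z)‖ + ‖f' (y - z)‖ := norm_le_norm_sub_add _ _
  have h5 : ‖f' (y - z)‖ ≤ ‖f y - f z - f' (y - z)‖ + ‖f y - f z‖ := by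
    rw [← norm_neg (f y - f z - _)]
    simpa using norm_add_le (-(f y - f z - f' (y - z))) (f y - f z)
  -- The upper bound comes with the factor `2 - 1/c`, which is at most `c` because `(c - 1)² ≥ 0`.
  have h6 : 2 - 1 / c ≤ c := by
    have : c * (2 - 1 / c) ≤ c * c := by
      have : c * (2 - 1 / c) = 2 * c - 1 := by field_simp
      nlinarith [sq_nonneg (c - 1)]
    exact le_of_mul_le_mul_left this hc0
  have hn := norm_nonneg (f' (y - z))
  constructor
  · nlinarith
  · have : 1 / c * ‖f' (y - z)‖ ≤ ‖f y - f z‖ := by linarith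
    calc ‖f' (y - z)‖ = c * (1 / c * ‖f' (y - z)‖) := by field_simp
      _ ≤ _ := by gcongr

theorem normDet_pos_of_injective {f : U →ₗ[ℝ] V} (hf : Function.Injective f) : 0 < f.normDet :=
  lt_of_le_of_ne f.normDet_nonneg (Ne.symm ((f.normDet_ne_zero_tfae.out 0 4).2 hf))

variable [MeasurableSpace U] [BorelSpace U] [MeasurableSpace V] [BorelSpace V]

/-- A local form of the area formula, up to a factor close to `1`. -/
theorem exists_isOpen_euclideanHausdorffMeasure_image_le {f : U → V} {f' : U → U →L[ℝ] V}
    {s : Set U} {x : U} (hx : x ∈ s) (hf : HasStrictFDerivAt f (f' x) x)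
    (hinj : Function.Injective (f' x))
    (hJ : ContinuousOn (fun x => (f' x).toLinearMap.normDet) s) {c : ℝ≥0} (hc : 1 < c) :
    ∃ W, IsOpen W ∧ x ∈ W ∧ ∀ t ⊆ s ∩ W, MeasurableSet t →
      μHE[finrank ℝ U] (f '' t) ≤ (c : ℝ≥0∞) ^ (finrank ℝ U + 1) *
        ∫⁻ y in t, ENNReal.ofReal (f' y).toLinearMap.normDet ∧
      ∫⁻ y in t, ENNReal.ofReal (f' y).toLinearMap.normDet ≤
        (c : ℝ≥0∞) ^ (finrank ℝ U + 1) * μHE[finrank ℝ U] (f '' t) := by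
  obtain ⟨W₁, hW₁, h₁⟩ := eventually_dist_le_of_hasStrictFDerivAt hf hinj (c := c) hc
  have hpos : 0 < (f' x).toLinearMap.normDet := normDet_pos_of_injective hinj
  have hcpos : (0 : ℝ) < c := by exact_mod_cast zero_lt_one.trans hc
  have hc' : (1 : ℝ) < c := hc
  -- The Jacobian varies by a factor at most `c` near `x`. Together with the `c ^ finrank ℝ U` from
  -- the bi-Lipschitz comparison with `f' x`, this gives the exponent `finrank ℝ U + 1`.
  have e₁ : ∀ᶠ y in 𝓝[s] x, (f' y).toLinearMap.normDet < c * (f' x).toLinearMap.normDet :=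
    (hJ x hx).eventually (gt_mem_nhds (by nlinarith))
  have e₂ : ∀ᶠ y in 𝓝[s] x, (f' x).toLinearMap.normDet / c < (f' y).toLinearMap.normDet :=
    (hJ x hx).eventually (lt_mem_nhds (by rw [div_lt_iff₀ hcpos]; nlinarith))
  obtain ⟨W₂, hW₂, h₂⟩ := mem_nhdsWithin_iff_exists_mem_nhds_inter.1 (e₁.and e₂)
  obtain ⟨W, hWsub, hWo, hxW⟩ := mem_nhds_iff.1 (inter_mem hW₁ hW₂)
  refine ⟨W, hWo, hxW, fun t ht htm => ?_⟩
  have hlin := (f' x).toLinearMap.euclideanHausdorffMeasure_image_eq_normDet_mul_volume t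
  set J := fun y => ENNReal.ofReal (f' y).toLinearMap.normDet with hJdef
  have hco : ENNReal.ofReal (c : ℝ) = c := ENNReal.ofReal_coe_nnreal
  have k₁ : ∫⁻ y in t, J y ≤ c * (J x * volume t) := by
    calc ∫⁻ y in t, J y ≤ ∫⁻ y in t, c * J x := by
          refine setLIntegral_mono' htm fun y hy => ?_
          rw [← hco, hJdef, ← ENNReal.ofReal_mul hcpos.le]
          exact ENNReal.ofReal_le_ofReal
            (h₂ ⟨(hWsub (ht hy).2).2, (ht hy).1⟩).1.le
      _ = _ := by rw [setLIntegral_const, mul_assoc]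
  have k₂ : J x * volume t ≤ c * ∫⁻ y in t, J y := by
    calc J x * volume t = ∫⁻ y in t, J x := by rw [setLIntegral_const]
      _ ≤ ∫⁻ y in t, c * J y := by
          refine setLIntegral_mono' htm fun y hy => ?_
          rw [← hco, hJdef, ← ENNReal.ofReal_mul hcpos.le]
          refine ENNReal.ofReal_le_ofReal ?_
          have := (h₂ ⟨(hWsub (ht hy).2).2, (ht hy).1⟩).2.le
          rw [div_le_iff₀ hcpos] at this
          linarith
      _ = _ := lintegral_const_mul' _ _ ENNReal.coe_ne_top
  have k₃ := hausdorffMeasure_image_le_of_dist_le (s := t) (f := f) (g := f' x) (K := c)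
    (fun y hy z hz => (h₁ y (hWsub (ht hy).2).1 z (hWsub (ht hz).2).1).1) (finrank ℝ U)
  have k₄ := hausdorffMeasure_image_le_of_dist_le (s := t) (f := f' x) (g := f) (K := c)
    (fun y hy z hz => (h₁ y (hWsub (ht hy).2).1 z (hWsub (ht hz).2).1).2) (finrank ℝ U)
  have hlin' : μHE[finrank ℝ U] (f' x '' t) = J x * volume t := hlin
  rw [hlin'] at k₃ k₄
  constructor
  · calc _ ≤ _ := k₃
      _ ≤ (c : ℝ≥0∞) ^ finrank ℝ U * (c * ∫⁻ y in t, J y) := by gcongr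
      _ = _ := by rw [pow_succ, mul_assoc]
  · calc _ ≤ _ := k₁
      _ ≤ c * ((c : ℝ≥0∞) ^ finrank ℝ U * μHE[finrank ℝ U] (f '' t)) := by gcongr
      _ = _ := by rw [pow_succ']; ring

variable {f : U → V} {f' : U → U →L[ℝ] V} {s : Set U}

/-- Countably many of the local neighbourhoods cover `s`. They are cut into disjoint measurable
pieces, whose images are again disjoint and measurable by injectivity, so the local estimates add up
with one common constant. Letting `c` tend to `1` then yields equality. -/
theorem euclideanHausdorffMeasure_image_le_of_one_lt (hs : MeasurableSet s)
    (hf : ∀ x ∈ s, HasStrictFDerivAt f (f' x) x) (hinj : ∀ x ∈ s, Function.Injective (f' x))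
    (hJ : ContinuousOn (fun x => (f' x).toLinearMap.normDet) s) (hfs : InjOn f s)
    {c : ℝ≥0} (hc : 1 < c) :
    μHE[finrank ℝ U] (f '' s) ≤ (c : ℝ≥0∞) ^ (finrank ℝ U + 1) *
        ∫⁻ y in s, ENNReal.ofReal (f' y).toLinearMap.normDet ∧
      ∫⁻ y in s, ENNReal.ofReal (f' y).toLinearMap.normDet ≤
        (c : ℝ≥0∞) ^ (finrank ℝ U + 1) * μHE[finrank ℝ U] (f '' s) := by
  choose! W hWo hxW hW using fun x (hx : x ∈ s) =>
    exists_isOpen_euclideanHausdorffMeasure_image_le hx (hf x hx) (hinj x hx) hJ hc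
  rcases s.eq_empty_or_nonempty with rfl | hne
  · simp
  obtain ⟨T, hTs, hTc, hT⟩ := TopologicalSpace.countable_cover_nhdsWithin (f := W) (s := s)
    fun x hx => mem_nhdsWithin_of_mem_nhds ((hWo x hx).mem_nhds (hxW x hx))
  have hTne : T.Nonempty := by
    obtain ⟨x, hx⟩ := hne
    obtain ⟨i, hi, -⟩ := mem_iUnion₂.1 (hT hx)
    exact ⟨i, hi⟩
  obtain ⟨a, rfl⟩ := hTc.exists_eq_range hTne
  have has : ∀ n, a n ∈ s := fun n => hTs ⟨n, rfl⟩
  let u := disjointed fun n => W (a n)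
  have hum : ∀ n, MeasurableSet (s ∩ u n) := fun n =>
    hs.inter (MeasurableSet.disjointed (fun i => (hWo _ (has i)).measurableSet) n)
  have hus : ∀ n, s ∩ u n ⊆ s ∩ W (a n) := fun n =>
    inter_subset_inter_right _ (disjointed_subset _ _)
  have hdisj : Pairwise (Function.onFun Disjoint fun n => s ∩ u n) :=
    pairwise_disjoint_mono (disjoint_disjointed _) fun n => inter_subset_right
  have hA : s = ⋃ n, s ∩ u n := by
    rw [← inter_iUnion, iUnion_disjointed, eq_comm, inter_eq_left]
    simpa using hT
  have hcont : ContinuousOn f s := fun x hx => (hf x hx).continuousAt.continuousWithinAt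
  have e₁ : ∫⁻ y in s, ENNReal.ofReal (f' y).toLinearMap.normDet =
      ∑' n, ∫⁻ y in s ∩ u n, ENNReal.ofReal (f' y).toLinearMap.normDet := by
    conv_lhs => rw [hA]
    rw [lintegral_iUnion hum hdisj]
  have e₂ : μHE[finrank ℝ U] (f '' s) = ∑' n, μHE[finrank ℝ U] (f '' (s ∩ u n)) := by
    conv_lhs => rw [hA, image_iUnion]
    refine measure_iUnion (fun i j hij => ?_) fun n => ?_
    · exact Disjoint.image (hdisj hij) hfs inter_subset_left inter_subset_left
    · exact (hum n).image_of_continuousOn_injOn (hcont.mono inter_subset_left)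
        (hfs.mono inter_subset_left)
  rw [e₁, e₂, ← ENNReal.tsum_mul_left, ← ENNReal.tsum_mul_left]
  exact ⟨ENNReal.tsum_le_tsum fun n => (hW _ (has n) _ (hus n) (hum n)).1,
    ENNReal.tsum_le_tsum fun n => (hW _ (has n) _ (hus n) (hum n)).2⟩

/-- **Area formula** for injective immersions. -/
theorem euclideanHausdorffMeasure_image_eq_lintegral_normDet (hs : MeasurableSet s)
    (hf : ∀ x ∈ s, HasStrictFDerivAt f (f' x) x) (hinj : ∀ x ∈ s, Function.Injective (f' x))
    (hJ : ContinuousOn (fun x => (f' x).toLinearMap.normDet) s) (hfs : InjOn f s) :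
    μHE[finrank ℝ U] (f '' s) = ∫⁻ y in s, ENNReal.ofReal (f' y).toLinearMap.normDet := by
  have hlim : ∀ A : ℝ≥0∞, Tendsto (fun c : ℝ≥0 => (c : ℝ≥0∞) ^ (finrank ℝ U + 1) * A)
      (𝓝[>] 1) (𝓝 A) := by
    intro A
    have h1 : Tendsto (fun c : ℝ≥0 => (c : ℝ≥0∞) ^ (finrank ℝ U + 1)) (𝓝[>] 1) (𝓝 1) := by
      have h2 : Continuous fun c : ℝ≥0 => (c : ℝ≥0∞) ^ (finrank ℝ U + 1) :=
        (ENNReal.continuous_pow _).comp ENNReal.continuous_coe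
      simpa using (h2.tendsto 1).mono_left nhdsWithin_le_nhds
    simpa using ENNReal.Tendsto.mul_const (b := A) h1 (Or.inl one_ne_zero)
  refine le_antisymm (ge_of_tendsto (hlim _) ?_) (ge_of_tendsto (hlim _) ?_)
  · filter_upwards [self_mem_nhdsWithin] with c hc
    exact (euclideanHausdorffMeasure_image_le_of_one_lt hs hf hinj hJ hfs hc).1
  · filter_upwards [self_mem_nhdsWithin] with c hc
    exact (euclideanHausdorffMeasure_image_le_of_one_lt hs hf hinj hJ hfs hc).2

/-- The Hausdorff measure on the image of an injective immersion is a pushforward. -/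
theorem map_withDensity_normDet (hs : MeasurableSet s)
    (hf : ∀ x ∈ s, HasStrictFDerivAt f (f' x) x) (hinj : ∀ x ∈ s, Function.Injective (f' x))
    (hJ : ContinuousOn (fun x => (f' x).toLinearMap.normDet) s) (hfs : InjOn f s) :
    Measure.map (s.domRestrict f) (Measure.comap (↑)
        (volume.withDensity fun x => ENNReal.ofReal (f' x).toLinearMap.normDet)) =
      μHE[finrank ℝ U].restrict (f '' s) := by
  have hcont : ContinuousOn f s := fun x hx => (hf x hx).continuousAt.continuousWithinAt
  have hemb := hcont.measurableEmbedding hs hfs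
  refine Measure.ext fun t ht => ?_
  have hpre : MeasurableSet ((↑) '' (s.domRestrict f ⁻¹' t) : Set U) :=
    (MeasurableEmbedding.subtype_coe hs).measurableSet_image.2 (hemb.measurable ht)
  have himg : f '' ((↑) '' (s.domRestrict f ⁻¹' t)) = t ∩ f '' s := by
    ext y
    constructor
    · rintro ⟨_, ⟨x, hx, rfl⟩, rfl⟩
      exact ⟨hx, x, x.2, rfl⟩
    · rintro ⟨hy, x, hx, rfl⟩
      exact ⟨x, ⟨⟨x, hx⟩, hy, rfl⟩, rfl⟩
  have hsub : ((↑) '' (s.domRestrict f ⁻¹' t) : Set U) ⊆ s := by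
    rintro _ ⟨x, -, rfl⟩
    exact x.2
  rw [hemb.map_apply, (MeasurableEmbedding.subtype_coe hs).comap_apply, withDensity_apply _ hpre,
    Measure.restrict_apply ht, ← himg,
    euclideanHausdorffMeasure_image_eq_lintegral_normDet hpre (fun x hx => hf x (hsub hx))
      (fun x hx => hinj x (hsub hx)) (hJ.mono hsub) (hfs.mono hsub)]

/-- Restricted to `s`, `f` is a measurable embedding, so the transfer holds for an arbitrary `g`.
This matters because `orientedPairing` is defined through a choice and its measurability is not
known beforehand. -/
theorem integrableOn_image_iff_integrableOn_normDet_mul (hs : MeasurableSet s)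
    (hf : ∀ x ∈ s, HasStrictFDerivAt f (f' x) x) (hinj : ∀ x ∈ s, Function.Injective (f' x))
    (hJ : ContinuousOn (fun x => (f' x).toLinearMap.normDet) s) (hfs : InjOn f s) (g : V → ℝ) :
    IntegrableOn g (f '' s) μHE[finrank ℝ U] ↔
      IntegrableOn (fun x => (f' x).toLinearMap.normDet * g (f x)) s := by
  have hcont : ContinuousOn f s := fun x hx => (hf x hx).continuousAt.continuousWithinAt
  rw [IntegrableOn, ← map_withDensity_normDet hs hf hinj hJ hfs,
    (hcont.measurableEmbedding hs hfs).integrable_map_iff]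
  simp only [Set.domRestrict_eq, ← Function.comp_assoc, ENNReal.ofReal]
  rw [← (MeasurableEmbedding.subtype_coe hs).integrable_map_iff, map_comap_subtype_coe hs,
    restrict_withDensity hs, integrable_withDensity_iff_integrable_coe_smul₀]
  · simp_rw [IntegrableOn, Real.coe_toNNReal _ (LinearMap.normDet_nonneg _), Function.comp_apply,
      smul_eq_mul]
  · exact (hJ.aemeasurable hs).real_toNNReal

theorem integral_image_eq_integral_normDet_mul (hs : MeasurableSet s)
    (hf : ∀ x ∈ s, HasStrictFDerivAt f (f' x) x) (hinj : ∀ x ∈ s, Function.Injective (f' x))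
    (hJ : ContinuousOn (fun x => (f' x).toLinearMap.normDet) s) (hfs : InjOn f s) (g : V → ℝ) :
    ∫ y in f '' s, g y ∂μHE[finrank ℝ U] = ∫ x in s, (f' x).toLinearMap.normDet * g (f x) := by
  have hcont : ContinuousOn f s := fun x hx => (hf x hx).continuousAt.continuousWithinAt
  rw [← map_withDensity_normDet hs hf hinj hJ hfs,
    (hcont.measurableEmbedding hs hfs).integral_map]
  simp only [Set.domRestrict_apply, ← Function.comp_apply (f := g), ENNReal.ofReal]
  rw [← (MeasurableEmbedding.subtype_coe hs).integral_map, map_comap_subtype_coe hs,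
    setIntegral_withDensity_eq_setIntegral_smul₀ (hJ.aemeasurable hs).real_toNNReal _ hs]
  congr with x
  rw [NNReal.smul_def, Real.coe_toNNReal _ (LinearMap.normDet_nonneg _), smul_eq_mul]

end AreaFormula

/-! ### The cross product and right-handed frames -/

theorem space_inner_eq (x y : Space) : inner ℝ x y = x 0 * y 0 + x 1 * y 1 + x 2 * y 2 := by
  simp [PiLp.inner_apply, Fin.sum_univ_three, mul_comm]

theorem cross_apply_zero (x y : Space) : cross x y 0 = x 1 * y 2 - x 2 * y 1 := by
  simp [cross, cross_apply]

theorem cross_apply_one (x y : Space) : cross x y 1 = x 2 * y 0 - x 0 * y 2 := by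
  simp [cross, cross_apply]

theorem cross_apply_two (x y : Space) : cross x y 2 = x 0 * y 1 - x 1 * y 0 := by
  simp [cross, cross_apply]

theorem cross_add_left (x y z : Space) : cross (x + y) z = cross x z + cross y z := by
  simp [cross]

theorem cross_add_right (x y z : Space) : cross x (y + z) = cross x y + cross x z := by
  simp [cross]

theorem cross_smul_left (c : ℝ) (x y : Space) : cross (c • x) y = c • cross x y := by
  simp [cross]

theorem cross_smul_right (c : ℝ) (x y : Space) : cross x (c • y) = c • cross x y := by
  simp [cross]

theorem cross_swap (x y : Space) : cross x y = -cross y x := by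
  ext i
  fin_cases i
  · simp only [PiLp.neg_apply, Fin.zero_eta, cross_apply_zero]
    ring
  · simp only [PiLp.neg_apply, Fin.mk_one, cross_apply_one]
    ring
  · simp only [PiLp.neg_apply, Fin.reduceFinMk, cross_apply_two]
    ring

theorem cross_same (x : Space) : cross x x = 0 := by
  simp [cross]

theorem inner_cross_rotate (x y z : Space) :
    inner ℝ (cross x y) z = inner ℝ (cross y z) x := by
  simp only [space_inner_eq, cross_apply_zero, cross_apply_one, cross_apply_two]
  ring

theorem inner_cross_cross (x y : Space) : inner ℝ (cross x y) (cross x y) =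
    inner ℝ x x * inner ℝ y y - inner ℝ x y ^ 2 := by
  simp only [space_inner_eq, cross_apply_zero, cross_apply_one, cross_apply_two]
  ring

/-- A direct orthonormal basis. -/
structure IsRightHanded (b : OrthonormalBasis (Fin 3) ℝ Space) : Prop where
  cross_zero_one : cross (b 0) (b 1) = b 2

section Frame

variable (b : OrthonormalBasis (Fin 3) ℝ Space)

theorem frame_expansion (v : Space) :
    v = inner ℝ (b 0) v • b 0 + inner ℝ (b 1) v • b 1 + inner ℝ (b 2) v • b 2 := by
  conv_lhs => rw [← b.sum_repr' v, Fin.sum_univ_three]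

/-- The product is orthogonal to `b 0` and `b 1`, and Lagrange's identity gives it norm `1`. -/
theorem cross_frame_eq_or : cross (b 0) (b 1) = b 2 ∨ cross (b 0) (b 1) = -b 2 := by
  have h0 : inner ℝ (b 0) (cross (b 0) (b 1)) = 0 := by
    rw [real_inner_comm, inner_cross_rotate, inner_cross_rotate, cross_same]
    simp
  have h1 : inner ℝ (b 1) (cross (b 0) (b 1)) = 0 := by
    rw [real_inner_comm, inner_cross_rotate, cross_same]
    simp
  have h := frame_expansion b (cross (b 0) (b 1))
  rw [h0, h1, zero_smul, zero_smul, zero_add, zero_add] at h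
  have hn := inner_cross_cross (b 0) (b 1)
  rw [h] at hn
  simp only [inner_smul_left, inner_smul_right, b.inner_eq_ite] at hn
  have hsq : inner ℝ (b 2) (cross (b 0) (b 1)) ^ 2 = 1 := by
    rw [pow_two]
    simpa using hn
  rcases sq_eq_one_iff.1 hsq with hn | hn <;> rw [hn] at h
  · left; simpa using h
  · right; simpa using h

variable {b}

theorem IsRightHanded.cross_one_two (hb : IsRightHanded b) : cross (b 1) (b 2) = b 0 := by
  have h0 : inner ℝ (b 0) (cross (b 1) (b 2)) = 1 := by
    rw [real_inner_comm, ← inner_cross_rotate, hb.cross_zero_one]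
    simp
  have h1 : inner ℝ (b 1) (cross (b 1) (b 2)) = 0 := by
    rw [real_inner_comm, inner_cross_rotate, inner_cross_rotate, cross_same]
    simp
  have h2 : inner ℝ (b 2) (cross (b 1) (b 2)) = 0 := by
    rw [real_inner_comm, inner_cross_rotate, cross_same]
    simp
  rw [frame_expansion b (cross (b 1) (b 2)), h0, h1, h2]
  simp

theorem IsRightHanded.cross_two_zero (hb : IsRightHanded b) : cross (b 2) (b 0) = b 1 := by
  have h1 : inner ℝ (b 1) (cross (b 2) (b 0)) = 1 := by
    rw [real_inner_comm, inner_cross_rotate, hb.cross_zero_one]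
    simp
  have h2 : inner ℝ (b 2) (cross (b 2) (b 0)) = 0 := by
    rw [real_inner_comm, inner_cross_rotate, inner_cross_rotate, cross_same]
    simp
  have h0 : inner ℝ (b 0) (cross (b 2) (b 0)) = 0 := by
    rw [real_inner_comm, inner_cross_rotate, cross_same]
    simp
  rw [frame_expansion b (cross (b 2) (b 0)), h0, h1, h2]
  simp

variable (b)

/-- The radial unit vector of angle `u` in the plane of `b 0` and `b 1`. -/
def radial (u : ℝ) : Space := Real.cos u • b 0 + Real.sin u • b 1

/-- The derivative of `radial b`. -/
def tangential (u : ℝ) : Space := -Real.sin u • b 0 + Real.cos u • b 1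

/-- The unit vector of latitude `θ` in the half plane of `radial b u` and `b 2`. -/
def latitude (u θ : ℝ) : Space := Real.cos θ • radial b u + Real.sin θ • b 2

/-- The derivative of `latitude b u`. -/
def colatitude (u θ : ℝ) : Space := -Real.sin θ • radial b u + Real.cos θ • b 2

theorem inner_radial_radial (u : ℝ) : inner ℝ (radial b u) (radial b u) = 1 := by
  simp only [radial, inner_add_left, inner_add_right, inner_smul_left, inner_smul_right,
    b.inner_eq_ite]
  simp
  linear_combination Real.sin_sq_add_cos_sq u

theorem inner_tangential_tangential (u : ℝ) : inner ℝ (tangential b u) (tangential b u) = 1 := by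
  simp only [tangential, inner_add_left, inner_add_right, inner_smul_left, inner_smul_right,
    b.inner_eq_ite]
  simp
  linear_combination Real.sin_sq_add_cos_sq u

theorem inner_radial_tangential (u : ℝ) : inner ℝ (radial b u) (tangential b u) = 0 := by
  simp only [radial, tangential, inner_add_left, inner_add_right, inner_smul_left,
    inner_smul_right, b.inner_eq_ite]
  simp
  ring

theorem inner_radial_two (u : ℝ) : inner ℝ (radial b u) (b 2) = 0 := by
  simp only [radial, inner_add_left, inner_smul_left, b.inner_eq_ite]
  simp

theorem inner_tangential_two (u : ℝ) : inner ℝ (tangential b u) (b 2) = 0 := by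
  simp only [tangential, inner_add_left, inner_smul_left, b.inner_eq_ite]
  simp

theorem inner_two_two : inner ℝ (b 2) (b 2) = 1 := by
  simp

theorem radial_expansion (u : ℝ) (v : Space) : v = inner ℝ (radial b u) v • radial b u +
    inner ℝ (tangential b u) v • tangential b u + inner ℝ (b 2) v • b 2 := by
  conv_lhs => rw [frame_expansion b v]
  simp only [radial, tangential, inner_add_left, inner_smul_left, conj_trivial]
  match_scalars
  · linear_combination -inner ℝ (b 0) v * Real.sin_sq_add_cos_sq u
  · linear_combination -inner ℝ (b 1) v * Real.sin_sq_add_cos_sq u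
  · ring

/-- All inner products between `radial b u`, `tangential b u`, and `b 2`. -/
theorem inner_radial_frame (u : ℝ) :
    inner ℝ (radial b u) (radial b u) = 1 ∧ inner ℝ (tangential b u) (tangential b u) = 1 ∧
    inner ℝ (b 2) (b 2) = 1 ∧ inner ℝ (radial b u) (tangential b u) = 0 ∧
    inner ℝ (tangential b u) (radial b u) = 0 ∧ inner ℝ (radial b u) (b 2) = 0 ∧
    inner ℝ (b 2) (radial b u) = 0 ∧ inner ℝ (tangential b u) (b 2) = 0 ∧
    inner ℝ (b 2) (tangential b u) = 0 :=
  ⟨inner_radial_radial b u, inner_tangential_tangential b u, inner_two_two b,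
    inner_radial_tangential b u, by rw [real_inner_comm, inner_radial_tangential],
    inner_radial_two b u, by rw [real_inner_comm, inner_radial_two],
    inner_tangential_two b u, by rw [real_inner_comm, inner_tangential_two]⟩

theorem inner_latitude_frame (u θ : ℝ) :
    inner ℝ (latitude b u θ) (latitude b u θ) = 1 ∧
    inner ℝ (colatitude b u θ) (colatitude b u θ) = 1 ∧
    inner ℝ (latitude b u θ) (colatitude b u θ) = 0 ∧
    inner ℝ (tangential b u) (latitude b u θ) = 0 ∧
    inner ℝ (tangential b u) (colatitude b u θ) = 0 := by
  obtain ⟨h1, h2, h3, h4, h5, h6, h7, h8, h9⟩ := inner_radial_frame b u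
  simp only [latitude, colatitude, inner_add_left, inner_add_right, inner_smul_left,
    inner_smul_right, h1, h3, h5, h6, h7, h8, conj_trivial]
  have := Real.sin_sq_add_cos_sq θ
  refine ⟨?_, ?_, ?_, ?_, ?_⟩ <;> linarith

theorem latitude_expansion (u θ : ℝ) (v : Space) : v = inner ℝ (latitude b u θ) v • latitude b u θ +
    inner ℝ (tangential b u) v • tangential b u +
    inner ℝ (colatitude b u θ) v • colatitude b u θ := by
  conv_lhs => rw [radial_expansion b u v]
  simp only [latitude, colatitude, inner_add_left, inner_smul_left, conj_trivial]
  match_scalars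
  · linear_combination -inner ℝ (radial b u) v * Real.sin_sq_add_cos_sq θ
  · ring
  · linear_combination -inner ℝ (b 2) v * Real.sin_sq_add_cos_sq θ

variable {b}

theorem IsRightHanded.cross_radial_tangential (hb : IsRightHanded b) (u : ℝ) :
    cross (radial b u) (tangential b u) = b 2 := by
  simp only [radial, tangential, cross_add_left, cross_add_right, cross_smul_left,
    cross_smul_right, cross_same, cross_swap (b 1) (b 0), hb.cross_zero_one]
  match_scalars
  linear_combination Real.sin_sq_add_cos_sq u

theorem IsRightHanded.cross_tangential_two (hb : IsRightHanded b) (u : ℝ) :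
    cross (tangential b u) (b 2) = radial b u := by
  simp only [radial, tangential, cross_add_left, cross_smul_left, cross_swap (b 0) (b 2),
    hb.cross_one_two, hb.cross_two_zero]
  module

theorem IsRightHanded.cross_two_radial (hb : IsRightHanded b) (u : ℝ) :
    cross (b 2) (radial b u) = tangential b u := by
  simp only [radial, tangential, cross_add_right, cross_smul_right, cross_swap (b 2) (b 1),
    hb.cross_one_two, hb.cross_two_zero]
  module

theorem IsRightHanded.cross_tangential_colatitude (hb : IsRightHanded b) (u θ : ℝ) :
    cross (tangential b u) (colatitude b u θ) = latitude b u θ := by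
  simp only [colatitude, latitude, cross_add_right, cross_smul_right,
    cross_swap (tangential b u) (radial b u), hb.cross_radial_tangential, hb.cross_tangential_two]
  module

theorem IsRightHanded.cross_tangential_latitude (hb : IsRightHanded b) (u θ : ℝ) :
    cross (tangential b u) (latitude b u θ) = -colatitude b u θ := by
  simp only [colatitude, latitude, cross_add_right, cross_smul_right,
    cross_swap (tangential b u) (radial b u), hb.cross_radial_tangential, hb.cross_tangential_two]
  module

theorem IsRightHanded.cross_colatitude_latitude (hb : IsRightHanded b) (u θ : ℝ) :
    cross (colatitude b u θ) (latitude b u θ) = tangential b u := by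
  simp only [colatitude, latitude, cross_add_left, cross_add_right, cross_smul_left,
    cross_smul_right, cross_same, cross_swap (radial b u) (b 2), hb.cross_two_radial]
  match_scalars
  linear_combination Real.sin_sq_add_cos_sq θ

variable (b)

theorem radial_injOn : InjOn (radial b) (Ioc 0 (2 * Real.pi)) := by
  intro u hu v hv h
  have h0 := congrArg (inner ℝ (b 0)) h
  have h1 := congrArg (inner ℝ (b 1)) h
  simp only [radial, inner_add_right, inner_smul_right, b.inner_eq_ite] at h0 h1
  simp at h0 h1
  obtain ⟨k, hk⟩ := Real.Angle.angle_eq_iff_two_pi_dvd_sub.1 (Real.Angle.cos_sin_inj h0 h1)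
  have hp := Real.pi_pos
  have : k = 0 := by
    have k1 : (k : ℝ) < 1 := by
      by_contra hc
      nlinarith [hu.2, hv.1]
    have k2 : (-1 : ℝ) < k := by
      by_contra hc
      nlinarith [hu.1, hv.2]
    norm_cast at k1 k2
    lia
  rw [this] at hk
  simp at hk
  linarith

/-- The angle is the argument of `x + iy`, moved into `(0, 2π]` by a multiple of `2π`. -/
theorem exists_radial_eq {x y : ℝ} (h : x ^ 2 + y ^ 2 = 1) :
    ∃ u ∈ Ioc 0 (2 * Real.pi), radial b u = x • b 0 + y • b 1 := by
  have hz : ‖(⟨x, y⟩ : ℂ)‖ = 1 := by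
    rw [← sq_eq_sq₀ (norm_nonneg _) zero_le_one, Complex.sq_norm, Complex.normSq_apply]
    simp only
    linarith
  have hne : (⟨x, y⟩ : ℂ) ≠ 0 := fun h => by simp [h] at hz
  have hx : Real.cos (Complex.arg ⟨x, y⟩) = x := by rw [Complex.cos_arg hne, hz, div_one]
  have hy : Real.sin (Complex.arg ⟨x, y⟩) = y := by rw [Complex.sin_arg, hz, div_one]
  obtain ⟨n, hn, -⟩ := existsUnique_add_zsmul_mem_Ioc (Real.two_pi_pos) (Complex.arg ⟨x, y⟩) 0
  refine ⟨_, by rwa [zero_add, zsmul_eq_mul] at hn, ?_⟩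
  rw [radial, Real.cos_add_int_mul_two_pi, Real.sin_add_int_mul_two_pi, hx, hy]

theorem hasStrictDerivAt_radial (u : ℝ) : HasStrictDerivAt (radial b) (tangential b u) u :=
  ((Real.hasStrictDerivAt_cos u).smul_const (b 0)).add
    ((Real.hasStrictDerivAt_sin u).smul_const (b 1))

theorem continuous_radial : Continuous (radial b) := by
  unfold radial
  fun_prop

end Frame

/-! ### The unit normal bundle above a circle, parametrized -/

instance : ContinuousSMul ℝ Total := IsBoundedSMul.continuousSMul

section Parametrization

variable (b : OrthonormalBasis (Fin 3) ℝ Space) (O : Space) (ρ : ℝ)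

/-- The point of angle `u` on the circle of center `O` and radius `ρ`. -/
def circlePoint (u : ℝ) : Space := O + ρ • radial b u

/-- The pair formed by a point of a circle and a unit vector orthogonal to the circle. -/
def bundlePoint (x : EuclideanSpace ℝ (Fin 2)) : Total :=
  WithLp.toLp 2 (circlePoint b O ρ (x 0), latitude b (x 0) (x 1))

/-- The first partial derivative of `bundlePoint`. -/
def bundleDerivZero (u θ : ℝ) : Total :=
  WithLp.toLp 2 (ρ • tangential b u, Real.cos θ • tangential b u)

/-- The second partial derivative of `bundlePoint`. -/
def bundleDerivOne (u θ : ℝ) : Total := WithLp.toLp 2 (0, colatitude b u θ)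

/-- The Fréchet derivative of `bundlePoint`. -/
def bundleFDeriv (x : EuclideanSpace ℝ (Fin 2)) : EuclideanSpace ℝ (Fin 2) →L[ℝ] Total :=
  (EuclideanSpace.proj 0).smulRight (bundleDerivZero b ρ (x 0) (x 1)) +
    (EuclideanSpace.proj 1).smulRight (bundleDerivOne b (x 0) (x 1))

theorem bundleFDeriv_apply (x v : EuclideanSpace ℝ (Fin 2)) : bundleFDeriv b ρ x v =
    v 0 • bundleDerivZero b ρ (x 0) (x 1) + v 1 • bundleDerivOne b (x 0) (x 1) := by
  simp [bundleFDeriv]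

theorem hasStrictFDerivAt_bundlePoint (x : EuclideanSpace ℝ (Fin 2)) :
    HasStrictFDerivAt (bundlePoint b O ρ) (bundleFDeriv b ρ x) x := by
  have p0 : HasStrictFDerivAt (fun x : EuclideanSpace ℝ (Fin 2) => x 0)
      (EuclideanSpace.proj 0 : EuclideanSpace ℝ (Fin 2) →L[ℝ] ℝ) x :=
    (EuclideanSpace.proj 0 : EuclideanSpace ℝ (Fin 2) →L[ℝ] ℝ).hasStrictFDerivAt
  have p1 : HasStrictFDerivAt (fun x : EuclideanSpace ℝ (Fin 2) => x 1)
      (EuclideanSpace.proj 1 : EuclideanSpace ℝ (Fin 2) →L[ℝ] ℝ) x :=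
    (EuclideanSpace.proj 1 : EuclideanSpace ℝ (Fin 2) →L[ℝ] ℝ).hasStrictFDerivAt
  have hr := (hasStrictDerivAt_radial b (x 0)).hasStrictFDerivAt.comp x p0
  have hc := (Real.hasStrictDerivAt_cos (x 1)).hasStrictFDerivAt.comp x p1
  have hs := (Real.hasStrictDerivAt_sin (x 1)).hasStrictFDerivAt.comp x p1
  have h1 := (hr.const_smul ρ).const_add O
  have h2 := (hc.smul hr).add (hs.smul_const (b 2))
  have h := (WithLp.prodContinuousLinearEquiv 2 ℝ Space Space).symm.hasStrictFDerivAt.comp x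
    (h1.prodMk h2)
  refine h.congr_fderiv ?_
  ext1 v
  apply (WithLp.prodContinuousLinearEquiv 2 ℝ Space Space).injective
  rw [bundleFDeriv_apply]
  ext1
  · simp [bundleDerivZero, bundleDerivOne, smul_smul, mul_comm]
  · simp [bundleDerivZero, bundleDerivOne, colatitude]
    module

theorem inner_bundleDerivZero (u θ : ℝ) :
    inner ℝ (bundleDerivZero b ρ u θ) (bundleDerivZero b ρ u θ) = ρ ^ 2 + Real.cos θ ^ 2 := by
  simp only [bundleDerivZero, WithLp.prod_inner_apply, inner_smul_left, inner_smul_right,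
    inner_tangential_tangential, conj_trivial]
  ring

theorem inner_bundleDerivOne (u θ : ℝ) :
    inner ℝ (bundleDerivOne b u θ) (bundleDerivOne b u θ) = 1 := by
  simp only [bundleDerivOne, WithLp.prod_inner_apply, (inner_latitude_frame b u θ).2.1,
    inner_zero_left, zero_add]

theorem inner_bundleDerivZero_bundleDerivOne (u θ : ℝ) :
    inner ℝ (bundleDerivZero b ρ u θ) (bundleDerivOne b u θ) = 0 := by
  simp only [bundleDerivZero, bundleDerivOne, WithLp.prod_inner_apply, inner_smul_left,
    (inner_latitude_frame b u θ).2.2.2.2, inner_zero_right, mul_zero, zero_add]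

/-- The partial derivatives are orthogonal and the second has norm `1`, so the Gram determinant is
the squared norm of the first. -/
theorem normDet_bundleFDeriv (x : EuclideanSpace ℝ (Fin 2)) :
    (bundleFDeriv b ρ x).toLinearMap.normDet = √(ρ ^ 2 + Real.cos (x 1) ^ 2) := by
  have h := (bundleFDeriv b ρ x).toLinearMap.normDet_sq_eq_det_gram
    (EuclideanSpace.basisFun (Fin 2) ℝ)
  have h0 : bundleFDeriv b ρ x (EuclideanSpace.basisFun (Fin 2) ℝ 0) =
      bundleDerivZero b ρ (x 0) (x 1) := by
    simp [bundleFDeriv_apply]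
  have h1 : bundleFDeriv b ρ x (EuclideanSpace.basisFun (Fin 2) ℝ 1) =
      bundleDerivOne b (x 0) (x 1) := by
    simp [bundleFDeriv_apply]
  rw [Matrix.det_fin_two] at h
  simp only [Matrix.gram_apply, ContinuousLinearMap.coe_coe, h0, h1, inner_bundleDerivZero,
    inner_bundleDerivOne, inner_bundleDerivZero_bundleDerivOne] at h
  rw [eq_comm, Real.sqrt_eq_iff_eq_sq (by positivity) (LinearMap.normDet_nonneg _)]
  simpa using h.symm

variable {ρ} in
theorem bundleFDeriv_injective (hρ : 0 < ρ) (x : EuclideanSpace ℝ (Fin 2)) :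
    Function.Injective (bundleFDeriv b ρ x) := by
  refine ((bundleFDeriv b ρ x).toLinearMap.normDet_ne_zero_tfae.out 0 4).1 ?_
  rw [normDet_bundleFDeriv]
  positivity

theorem continuous_normDet_bundleFDeriv :
    Continuous fun x => (bundleFDeriv b ρ x).toLinearMap.normDet := by
  simp only [normDet_bundleFDeriv]
  fun_prop

theorem circlePoint_injOn {ρ : ℝ} (hρ : ρ ≠ 0) :
    InjOn (circlePoint b O ρ) (Ioc 0 (2 * Real.pi)) := by
  intro u hu v hv h
  refine radial_injOn b hu hv (smul_right_injective _ hρ ?_)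
  exact add_left_cancel h

theorem inner_two_latitude (u θ : ℝ) : inner ℝ (b 2) (latitude b u θ) = Real.sin θ := by
  simp only [latitude, inner_add_right, inner_smul_right, inner_two_two,
    (inner_radial_frame b u).2.2.2.2.2.2.1]
  simp

/-- The base point determines the angle `u`; the component of the normal along `b 2` is `sin θ`,
which determines `θ` between `-π/2` and `π/2`. -/
theorem bundlePoint_injOn {ρ : ℝ} (hρ : ρ ≠ 0) : InjOn (bundlePoint b O ρ)
    {x | x 0 ∈ Ioc 0 (2 * Real.pi) ∧ x 1 ∈ Icc (-(Real.pi / 2)) (Real.pi / 2)} := by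
  intro x hx y hy h
  have h1 : circlePoint b O ρ (x 0) = circlePoint b O ρ (y 0) := congrArg WithLp.fst h
  have h2 : latitude b (x 0) (x 1) = latitude b (y 0) (y 1) := congrArg WithLp.snd h
  have e0 := circlePoint_injOn b O hρ hx.1 hy.1 h1
  have e1 : x 1 = y 1 := by
    refine Real.injOn_sin hx.2 hy.2 ?_
    rw [← inner_two_latitude b (x 0), h2, inner_two_latitude]
  ext i
  fin_cases i
  · exact e0
  · exact e1

/-- Arc length on a circle. -/
theorem euclideanHausdorffMeasure_circlePoint_image {ρ : ℝ} (hρ : 0 < ρ) {s : Set ℝ}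
    (hs : MeasurableSet s) (hs' : s ⊆ Ioc 0 (2 * Real.pi)) :
    μHE[1] (circlePoint b O ρ '' s) = ENNReal.ofReal ρ * volume s := by
  have hd : ∀ u, HasStrictFDerivAt (circlePoint b O ρ)
      (ContinuousLinearMap.toSpanSingleton ℝ (ρ • tangential b u)) u := fun u =>
    (((hasStrictDerivAt_radial b u).const_smul ρ).const_add O).hasStrictFDerivAt
  have hJ : ∀ u, (ContinuousLinearMap.toSpanSingleton ℝ (ρ • tangential b u)).toLinearMap.normDet
      = ρ := by
    intro u
    have h := (ContinuousLinearMap.toSpanSingleton ℝ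
      (ρ • tangential b u)).toLinearMap.normDet_sq_eq_det_gram (OrthonormalBasis.singleton Unit ℝ)
    rw [Matrix.det_unique] at h
    simp only [Matrix.gram_apply, ContinuousLinearMap.coe_coe, OrthonormalBasis.singleton_apply,
      ContinuousLinearMap.toSpanSingleton_apply, one_smul, inner_smul_left, inner_smul_right,
      inner_tangential_tangential] at h
    rw [← sq_eq_sq₀ (LinearMap.normDet_nonneg _) hρ.le]
    simpa [pow_two] using h
  have hi : ∀ u, Function.Injective
      (ContinuousLinearMap.toSpanSingleton ℝ (ρ • tangential b u)) := by
    intro u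
    refine (LinearMap.normDet_ne_zero_tfae (ContinuousLinearMap.toSpanSingleton ℝ
      (ρ • tangential b u)).toLinearMap |>.out 0 4).1 ?_
    rw [hJ]
    exact hρ.ne'
  have h := euclideanHausdorffMeasure_image_eq_lintegral_normDet hs (fun u _ => hd u)
    (fun u _ => hi u) (by simp only [hJ]; exact continuousOn_const)
    ((circlePoint_injOn b O hρ.ne').mono hs')
  simp only [hJ, setLIntegral_const] at h
  simpa using h

/-- A continuously differentiable curve has no two-dimensional measure. -/
theorem euclideanHausdorffMeasure_two_range_eq_zero {c : ℝ → Total} (hc : ContDiff ℝ 1 c) :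
    μHE[2] (range c) = 0 := by
  have h1 := hc.dimH_range_le
  have h2 : μH[((2 : ℝ≥0) : ℝ)] (range c) = 0 := by
    refine hausdorffMeasure_of_dimH_lt (h1.trans_lt ?_)
    simp
  rw [Measure.euclideanHausdorffMeasure_def, Measure.smul_apply]
  simp only [NNReal.coe_ofNat] at h2
  simp [h2]

end Parametrization

/-! ### Normal cones of balls and of lenses -/

section NormalCone

/-- At a boundary point, `‖p + t v - A‖² - r² = t (2⟨v, p - A⟩ + t‖v‖²)` is negative for small `t >
0`; at an interior point continuity suffices. -/
theorem eventually_mem_closedBall_of_inner_neg {A p v : Space} {r : ℝ} (hp : dist p A ≤ r)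
    (hv : dist p A = r → inner ℝ v (p - A) < 0) :
    ∀ᶠ t : ℝ in 𝓝[>] 0, p + t • v ∈ Metric.closedBall A r := by
  rcases hp.lt_or_eq with h | h
  · have hc : Tendsto (fun t : ℝ => dist (p + t • v) A) (𝓝[>] 0) (𝓝 (dist p A)) := by
      have : Continuous fun t : ℝ => dist (p + t • v) A := by fun_prop
      simpa using (this.tendsto 0).mono_left nhdsWithin_le_nhds
    filter_upwards [hc.eventually (gt_mem_nhds h)] with t ht using ht.le
  · have hc : Tendsto (fun t : ℝ => 2 * inner ℝ v (p - A) + t * inner ℝ v v) (𝓝[>] 0)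
        (𝓝 (2 * inner ℝ v (p - A))) := by
      have : Continuous fun t : ℝ => 2 * inner ℝ v (p - A) + t * inner ℝ v v := by fun_prop
      simpa using (this.tendsto 0).mono_left nhdsWithin_le_nhds
    have hneg := hv h
    filter_upwards [hc.eventually (gt_mem_nhds (show _ < (0 : ℝ) by linarith)),
      self_mem_nhdsWithin] with t ht ht0
    have hr : 0 ≤ r := h ▸ dist_nonneg
    rw [mem_closedBall_iff_norm, ← sq_le_sq₀ (norm_nonneg _) hr, ← h, dist_eq_norm,
      ← real_inner_self_eq_norm_sq, ← real_inner_self_eq_norm_sq]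
    have e : p + t • v - A = (p - A) + t • v := by abel
    rw [e]
    simp only [inner_add_left, inner_add_right, inner_smul_left, inner_smul_right, conj_trivial]
    rw [real_inner_comm v (p - A)]
    nlinarith [mem_Ioi.1 ht0]

theorem inner_nonpos_of_eventually_mem {K : Set Space} {p n v : Space} (hn : n ∈ normalCone K p)
    (hv : ∀ᶠ t : ℝ in 𝓝[>] 0, p + t • v ∈ K) : inner ℝ n v ≤ 0 := by
  obtain ⟨t, ht, ht0⟩ := (hv.and self_mem_nhdsWithin).exists
  have h := hn.2 _ ht
  rw [add_sub_cancel_left, inner_smul_right] at h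
  exact nonpos_of_mul_nonpos_right h ht0

/-- The normal cone at a point near which a convex set looks like a ball. -/
theorem eq_smul_of_mem_normalCone {K : Set Space} {A p n : Space} {r : ℝ} (hr : 0 < r)
    (hp : dist p A = r) (hn : n ∈ normalCone K p)
    (hK : ∀ v, inner ℝ v (p - A) < 0 → ∀ᶠ t : ℝ in 𝓝[>] 0, p + t • v ∈ K) :
    n = r⁻¹ • (p - A) := by
  have hm : ‖r⁻¹ • (p - A)‖ = 1 := by
    rw [norm_smul, ← dist_eq_norm, hp, Real.norm_of_nonneg (by positivity), inv_mul_cancel₀ hr.ne']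
  have hnn : inner ℝ n n = 1 := by rw [real_inner_self_eq_norm_sq, hn.1, one_pow]
  have hmm : inner ℝ (r⁻¹ • (p - A)) (r⁻¹ • (p - A)) = (1 : ℝ) := by
    rw [real_inner_self_eq_norm_sq, hm, one_pow]
  set m := r⁻¹ • (p - A) with hmdef
  have hpA : p - A = r • m := by rw [hmdef, smul_inv_smul₀ hr.ne']
  refine (inner_eq_one_iff_of_norm_eq_one (𝕜 := ℝ) hn.1 hm).1 ?_
  refine le_antisymm ?_ ?_
  · simpa [hn.1, hm] using real_inner_le_norm n m
  · by_contra! hlt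
    -- If `⟨n, m⟩ < 1`, the direction `n - m` enters `K` because `⟨n - m, m⟩ < 0`, yet `⟨n, n - m⟩ =
    -- 1 - ⟨n, m⟩ > 0`, against normality of `n`.
    have h1 : inner ℝ (n - m) (p - A) < 0 := by
      rw [hpA, inner_smul_right, inner_sub_left, hmm]
      nlinarith
    have h2 := inner_nonpos_of_eventually_mem hn (hK _ h1)
    rw [inner_sub_right, hnn] at h2
    linarith

theorem mem_normalBundle_closedBall {A : Space} {r : ℝ} (hr : 0 < r) {a : Total}
    (ha : a ∈ normalBundle (Metric.closedBall A r)) : a.snd = r⁻¹ • (a.fst - A) := by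
  have hp : dist a.fst A = r := by
    have := ha.1
    rw [frontier_closedBall A hr.ne'] at this
    exact this
  exact eq_smul_of_mem_normalCone hr hp ha.2 fun v hv =>
    eventually_mem_closedBall_of_inner_neg hp.le fun _ => hv

/-- The intersection of two balls of radius `r` whose boundaries meet along the circle of center
`O` and radius `r cos α` in the plane of `b 0` and `b 1`. -/
def lens (b : OrthonormalBasis (Fin 3) ℝ Space) (O : Space) (r α : ℝ) : Set Space :=
  Metric.closedBall (O - (r * Real.sin α) • b 2) r ∩
    Metric.closedBall (O + (r * Real.sin α) • b 2) r

variable (b : OrthonormalBasis (Fin 3) ℝ Space) (O : Space) {r α : ℝ}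

theorem circlePoint_sub_sub (u : ℝ) : circlePoint b O (r * Real.cos α) u -
    (O - (r * Real.sin α) • b 2) = r • latitude b u α := by
  simp only [circlePoint, latitude]
  module

theorem circlePoint_sub_add (u : ℝ) : circlePoint b O (r * Real.cos α) u -
    (O + (r * Real.sin α) • b 2) = r • latitude b u (-α) := by
  simp only [circlePoint, latitude, Real.cos_neg, Real.sin_neg]
  module

theorem norm_latitude (u θ : ℝ) : ‖latitude b u θ‖ = 1 := by
  rw [← sq_eq_sq₀ (norm_nonneg _) zero_le_one, ← real_inner_self_eq_norm_sq,
    (inner_latitude_frame b u θ).1, one_pow]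

theorem dist_circlePoint_sub (hr : 0 < r) (u : ℝ) :
    dist (circlePoint b O (r * Real.cos α) u) (O - (r * Real.sin α) • b 2) = r := by
  rw [dist_eq_norm, circlePoint_sub_sub, norm_smul, norm_latitude, mul_one,
    Real.norm_of_nonneg hr.le]

theorem dist_circlePoint_add (hr : 0 < r) (u : ℝ) :
    dist (circlePoint b O (r * Real.cos α) u) (O + (r * Real.sin α) • b 2) = r := by
  rw [dist_eq_norm, circlePoint_sub_add, norm_smul, norm_latitude, mul_one,
    Real.norm_of_nonneg hr.le]

theorem norm_sq_eq_sum_frame (v : Space) :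
    ‖v‖ ^ 2 = inner ℝ (b 0) v ^ 2 + inner ℝ (b 1) v ^ 2 + inner ℝ (b 2) v ^ 2 := by
  have := b.sum_sq_norm_inner_right v
  rw [Fin.sum_univ_three] at this
  simpa using this.symm

/-- Subtracting the two sphere equations leaves `4 r sin α` times the axial coordinate, which must
vanish; either equation then reduces to that of the circle. -/
theorem inner_frame_of_dist_eq (hr : 0 < r) (hα : α ∈ Ioo 0 (Real.pi / 2)) {p : Space}
    (h₁ : dist p (O - (r * Real.sin α) • b 2) = r)
    (h₂ : dist p (O + (r * Real.sin α) • b 2) = r) :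
    inner ℝ (b 2) (p - O) = 0 ∧
      inner ℝ (b 0) (p - O) ^ 2 + inner ℝ (b 1) (p - O) ^ 2 = (r * Real.cos α) ^ 2 := by
  have hs : 0 < Real.sin α := Real.sin_pos_of_pos_of_lt_pi hα.1 (by linarith [hα.2, Real.pi_pos])
  have e₁ : p - (O - (r * Real.sin α) • b 2) = (p - O) + (r * Real.sin α) • b 2 := by abel
  have e₂ : p - (O + (r * Real.sin α) • b 2) = (p - O) - (r * Real.sin α) • b 2 := by abel
  have k₁ := norm_sq_eq_sum_frame b (p - (O - (r * Real.sin α) • b 2))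
  have k₂ := norm_sq_eq_sum_frame b (p - (O + (r * Real.sin α) • b 2))
  rw [← dist_eq_norm, h₁, e₁] at k₁
  rw [← dist_eq_norm, h₂, e₂] at k₂
  simp only [inner_add_right, inner_sub_right, inner_smul_right, b.inner_eq_ite] at k₁ k₂
  simp at k₁ k₂
  have hz : inner ℝ (b 2) (p - O) = 0 := by
    have : (4 * r * Real.sin α) * inner ℝ (b 2) (p - O) = 0 := by
      simp only [inner_sub_right]
      linear_combination k₂ - k₁
    exact (mul_eq_zero.1 this).resolve_left (by positivity)
  refine ⟨hz, ?_⟩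
  simp only [inner_sub_right] at hz ⊢
  rw [hz] at k₁
  linear_combination -k₁ - r ^ 2 * Real.sin_sq_add_cos_sq α

theorem exists_circlePoint_eq (hr : 0 < r) (hα : α ∈ Ioo 0 (Real.pi / 2)) {p : Space}
    (h₁ : dist p (O - (r * Real.sin α) • b 2) = r)
    (h₂ : dist p (O + (r * Real.sin α) • b 2) = r) :
    ∃ u ∈ Ioc 0 (2 * Real.pi), circlePoint b O (r * Real.cos α) u = p := by
  have hc : 0 < Real.cos α := Real.cos_pos_of_mem_Ioo ⟨by linarith [hα.1, Real.pi_pos], hα.2⟩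
  have hρ : 0 < r * Real.cos α := mul_pos hr hc
  obtain ⟨hz, hxy⟩ := inner_frame_of_dist_eq b O hr hα h₁ h₂
  obtain ⟨u, hu, hru⟩ := exists_radial_eq b (x := inner ℝ (b 0) (p - O) / (r * Real.cos α))
    (y := inner ℝ (b 1) (p - O) / (r * Real.cos α)) (by
      rw [div_pow, div_pow, ← add_div, hxy, div_self (by positivity)])
  refine ⟨u, hu, ?_⟩
  rw [circlePoint, hru, smul_add, smul_smul, smul_smul, mul_div_cancel₀ _ hρ.ne',
    mul_div_cancel₀ _ hρ.ne', ← eq_sub_iff_add_eq']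
  conv_rhs => rw [frame_expansion b (p - O), hz, zero_smul, add_zero]

theorem inner_sub_nonpos_of_mem_closedBall {A p x : Space} {r : ℝ} (hp : dist p A = r)
    (hx : x ∈ Metric.closedBall A r) : inner ℝ (p - A) (x - p) ≤ 0 := by
  have e : x - p = (x - A) - (p - A) := by abel
  have h := real_inner_le_norm (p - A) (x - A)
  rw [← dist_eq_norm, hp] at h
  rw [e, inner_sub_right, real_inner_self_eq_norm_sq, ← dist_eq_norm, hp]
  have h' : ‖x - A‖ ≤ r := mem_closedBall_iff_norm.1 hx
  have hr : 0 ≤ r := hp ▸ dist_nonneg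
  nlinarith

/-- The normal cone of a lens at a point of its edge. -/
theorem mem_normalCone_lens_iff (hr : 0 < r) (hα : α ∈ Ioo 0 (Real.pi / 2)) (u : ℝ) (n : Space) :
    n ∈ normalCone (lens b O r α) (circlePoint b O (r * Real.cos α) u) ↔
      ∃ θ ∈ Icc (-α) α, latitude b u θ = n := by
  have hpi := Real.pi_pos
  have hs : 0 < Real.sin α := Real.sin_pos_of_pos_of_lt_pi hα.1 (by linarith [hα.2])
  have hc : 0 < Real.cos α := Real.cos_pos_of_mem_Ioo ⟨by linarith [hα.1], hα.2⟩
  have hd₁ := dist_circlePoint_sub b O (α := α) hr u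
  have hd₂ := dist_circlePoint_add b O (α := α) hr u
  have he₁ := circlePoint_sub_sub b O (r := r) (α := α) u
  have he₂ := circlePoint_sub_add b O (r := r) (α := α) u
  set p := circlePoint b O (r * Real.cos α) u
  constructor
  · intro hn
    obtain ⟨h1, h2, h3, h4, h5, h6, h7, h8, h9⟩ := inner_radial_frame b u
    have key : ∀ v, inner ℝ v (latitude b u α) < 0 → inner ℝ v (latitude b u (-α)) < 0 →
        inner ℝ n v ≤ 0 := by
      intro v hv₁ hv₂
      refine inner_nonpos_of_eventually_mem hn ?_
      have k₁ := eventually_mem_closedBall_of_inner_neg (v := v) hd₁.le fun _ => by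
        rw [he₁, inner_smul_right]
        exact mul_neg_of_pos_of_neg hr hv₁
      have k₂ := eventually_mem_closedBall_of_inner_neg (v := v) hd₂.le fun _ => by
        rw [he₂, inner_smul_right]
        exact mul_neg_of_pos_of_neg hr hv₂
      exact k₁.and k₂
    set x := inner ℝ n (radial b u) with hx
    set y := inner ℝ n (tangential b u) with hy
    set z := inner ℝ n (b 2) with hz
    have key' : ∀ c₀ c₁ c₂ : ℝ, c₀ * Real.cos α + c₂ * Real.sin α < 0 →
        c₀ * Real.cos α - c₂ * Real.sin α < 0 → c₀ * x + c₁ * y + c₂ * z ≤ 0 := by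
      intro c₀ c₁ c₂ hc₁ hc₂
      have := key (c₀ • radial b u + c₁ • tangential b u + c₂ • b 2) (by
        simp only [latitude, inner_add_left, inner_add_right, inner_smul_left, inner_smul_right,
          h1, h3, h5, h6, h7, h8, conj_trivial]
        linarith) (by
        simp only [latitude, inner_add_left, inner_add_right, inner_smul_left, inner_smul_right,
          h1, h3, h5, h6, h7, h8, conj_trivial, Real.cos_neg, Real.sin_neg]
        linarith)
      simpa only [inner_add_right, inner_smul_right] using this
    -- A weak inequality is the limit of strict ones: lowering the radial coefficient by `ε` moves
    -- the direction strictly into both balls.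
    have closed : ∀ c₀ c₁ c₂ : ℝ, c₀ * Real.cos α + c₂ * Real.sin α ≤ 0 →
        c₀ * Real.cos α - c₂ * Real.sin α ≤ 0 → c₀ * x + c₁ * y + c₂ * z ≤ 0 := by
      intro c₀ c₁ c₂ hc₁ hc₂
      have hlim : Tendsto (fun ε : ℝ => (c₀ - ε) * x + c₁ * y + c₂ * z) (𝓝[>] 0)
          (𝓝 (c₀ * x + c₁ * y + c₂ * z)) := by
        have : Continuous fun ε : ℝ => (c₀ - ε) * x + c₁ * y + c₂ * z := by fun_prop
        simpa using (this.tendsto 0).mono_left nhdsWithin_le_nhds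
      refine le_of_tendsto hlim ?_
      filter_upwards [self_mem_nhdsWithin] with ε hε
      have : 0 < ε * Real.cos α := mul_pos hε hc
      exact key' _ _ _ (by linarith) (by linarith)
    -- Both tangent directions of the edge are admissible, so `n` has no tangential component.
    have hy0 : y = 0 := by
      have a₁ := closed 0 1 0 (by simp) (by simp)
      have a₂ := closed 0 (-1) 0 (by simp) (by simp)
      linarith
    -- The two test directions are orthogonal to the extreme normals of latitudes `α` and `-α`. They
    -- give `z cos α ≤ x sin α` and `-z cos α ≤ x sin α`, that is `|θ| ≤ α` for `z = sin θ`, `x =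
    -- cos θ`.
    have b₁ := closed (-Real.sin α) 0 (Real.cos α) (by linarith) (by
      have := mul_pos hs hc
      linarith)
    have b₂ := closed (-Real.sin α) 0 (-Real.cos α) (by
      have := mul_pos hs hc
      linarith) (by linarith)
    have hexp : n = x • radial b u + z • b 2 := by
      have := radial_expansion b u n
      rw [real_inner_comm, ← hx, real_inner_comm, ← hy, hy0, real_inner_comm, ← hz, zero_smul,
        add_zero] at this
      exact this
    have hxz : x ^ 2 + z ^ 2 = 1 := by
      have := real_inner_self_eq_norm_sq n
      rw [hn.1, hexp] at this
      simp only [inner_add_left, inner_add_right, inner_smul_left, inner_smul_right, h1, h3, h6,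
        h7, conj_trivial] at this
      linarith
    have hx0 : 0 ≤ x := by nlinarith
    have hz1 : -1 ≤ z := by nlinarith [sq_nonneg x]
    have hz2 : z ≤ 1 := by nlinarith [sq_nonneg x]
    have hcos : Real.cos (Real.arcsin z) = x := by
      rw [Real.cos_arcsin, Real.sqrt_eq_iff_eq_sq (by nlinarith [sq_nonneg x]) hx0]
      linarith
    have hsin : Real.sin (Real.arcsin z) = z := Real.sin_arcsin hz1 hz2
    have hlow := Real.neg_pi_div_two_le_arcsin z
    have hup := Real.arcsin_le_pi_div_two z
    refine ⟨Real.arcsin z, ⟨?_, ?_⟩, ?_⟩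
    · by_contra! hlt
      have : Real.sin (Real.arcsin z + α) < 0 :=
        Real.sin_neg_of_neg_of_neg_pi_lt (by linarith) (by linarith [hα.1])
      rw [Real.sin_add, hsin, hcos] at this
      linarith
    · by_contra! hlt
      have : 0 < Real.sin (Real.arcsin z - α) :=
        Real.sin_pos_of_pos_of_lt_pi (by linarith) (by linarith [hα.1])
      rw [Real.sin_sub, hsin, hcos] at this
      linarith
    · rw [latitude, hcos, hsin, ← hexp]
  · rintro ⟨θ, hθ, rfl⟩
    refine ⟨norm_latitude b u θ, fun x hx => ?_⟩
    have k₁ := inner_sub_nonpos_of_mem_closedBall hd₁ hx.1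
    have k₂ := inner_sub_nonpos_of_mem_closedBall hd₂ hx.2
    rw [he₁, inner_smul_left] at k₁
    rw [he₂, inner_smul_left] at k₂
    have k₁' : inner ℝ (latitude b u α) (x - p) ≤ 0 := nonpos_of_mul_nonpos_right k₁ hr
    have k₂' : inner ℝ (latitude b u (-α)) (x - p) ≤ 0 := nonpos_of_mul_nonpos_right k₂ hr
    have s₁ : 0 ≤ Real.sin (α + θ) :=
      Real.sin_nonneg_of_nonneg_of_le_pi (by linarith [hθ.1]) (by linarith [hθ.2, hα.2])
    have s₂ : 0 ≤ Real.sin (α - θ) :=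
      Real.sin_nonneg_of_nonneg_of_le_pi (by linarith [hθ.2]) (by linarith [hθ.1, hα.2])
    -- A normal of latitude between `-α` and `α` is a nonnegative combination of the two sphere
    -- normals, with weights given by the addition formulas.
    have hcomb : (2 * Real.sin α * Real.cos α) • latitude b u θ =
        Real.sin (α + θ) • latitude b u α + Real.sin (α - θ) • latitude b u (-α) := by
      simp only [latitude, Real.cos_neg, Real.sin_neg, Real.sin_add, Real.sin_sub]
      match_scalars <;> ring
    have h := congrArg (fun v => inner ℝ v (x - p)) hcomb
    simp only [inner_add_left, inner_smul_left, conj_trivial] at h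
    have hpos : 0 < 2 * Real.sin α * Real.cos α := by positivity
    refine nonpos_of_mul_nonpos_right (a := 2 * Real.sin α * Real.cos α) ?_ hpos
    rw [h]
    nlinarith

theorem mem_frontier_lens (hr : 0 < r) {p : Space} :
    p ∈ frontier (lens b O r α) ↔ p ∈ lens b O r α ∧
      (dist p (O - (r * Real.sin α) • b 2) = r ∨ dist p (O + (r * Real.sin α) • b 2) = r) := by
  have hcl : IsClosed (lens b O r α) := Metric.isClosed_closedBall.inter Metric.isClosed_closedBall
  rw [hcl.frontier_eq, lens, interior_inter, interior_closedBall _ hr.ne',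
    interior_closedBall _ hr.ne']
  simp only [Set.mem_sdiff, mem_inter_iff, Metric.mem_closedBall, Metric.mem_ball, not_and, not_lt]
  constructor
  · rintro ⟨⟨h₁, h₂⟩, h⟩
    refine ⟨⟨h₁, h₂⟩, ?_⟩
    rcases h₁.lt_or_eq with h₁ | h₁
    · exact Or.inr (le_antisymm h₂ (h h₁))
    · exact Or.inl h₁
  · rintro ⟨⟨h₁, h₂⟩, h⟩
    refine ⟨⟨h₁, h₂⟩, fun h₁' => ?_⟩
    rcases h with h | h
    · exact absurd h h₁'.ne
    · exact h.ge

theorem circlePoint_mem_frontier_lens (hr : 0 < r) (u : ℝ) :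
    circlePoint b O (r * Real.cos α) u ∈ frontier (lens b O r α) :=
  (mem_frontier_lens b O hr).2 ⟨⟨(dist_circlePoint_sub b O hr u).le,
    (dist_circlePoint_add b O hr u).le⟩, Or.inl (dist_circlePoint_sub b O hr u)⟩

theorem bundlePoint_mem_normalBundle_lens (hr : 0 < r) (hα : α ∈ Ioo 0 (Real.pi / 2))
    {x : EuclideanSpace ℝ (Fin 2)} (hx : x 1 ∈ Icc (-α) α) :
    bundlePoint b O (r * Real.cos α) x ∈ normalBundle (lens b O r α) :=
  ⟨circlePoint_mem_frontier_lens b O hr _, (mem_normalCone_lens_iff b O hr hα _ _).2 ⟨_, hx, rfl⟩⟩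

/-- The part of the unit normal bundle of a lens above its edge. -/
theorem normalBundle_lens_inter_above (hr : 0 < r) (hα : α ∈ Ioo 0 (Real.pi / 2)) {A : Set Space}
    (hA : A ⊆ Metric.sphere (O - (r * Real.sin α) • b 2) r ∩
      Metric.sphere (O + (r * Real.sin α) • b 2) r) :
    normalBundle (lens b O r α) ∩ above A = bundlePoint b O (r * Real.cos α) ''
      {x | (x 0 ∈ Ioc 0 (2 * Real.pi) ∧ circlePoint b O (r * Real.cos α) (x 0) ∈ A) ∧
        x 1 ∈ Icc (-α) α} := by
  ext a
  constructor
  · rintro ⟨⟨-, ha⟩, haA⟩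
    obtain ⟨u, hu, hup⟩ := exists_circlePoint_eq b O hr hα (hA haA).1 (hA haA).2
    rw [← hup] at ha
    obtain ⟨θ, hθ, hθn⟩ := (mem_normalCone_lens_iff b O hr hα _ _).1 ha
    refine ⟨!₂[u, θ], ⟨⟨hu, ?_⟩, hθ⟩, ?_⟩
    · change circlePoint b O (r * Real.cos α) u ∈ A
      rw [hup]
      exact haA
    · change WithLp.toLp 2 (circlePoint b O (r * Real.cos α) u, latitude b u θ) = a
      rw [hup, hθn]
      rfl
  · rintro ⟨x, ⟨⟨-, hx⟩, hx1⟩, rfl⟩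
    exact ⟨bundlePoint_mem_normalBundle_lens b O hr hα hx1, hx⟩

/-- Away from the two spherical parts, the unit normal bundle of a lens lies above the edge. -/
theorem dist_eq_of_mem_normalBundle_lens (hr : 0 < r) {a : Total}
    (ha : a ∈ normalBundle (lens b O r α))
    (h₁ : a.snd ≠ r⁻¹ • (a.fst - (O - (r * Real.sin α) • b 2)))
    (h₂ : a.snd ≠ r⁻¹ • (a.fst - (O + (r * Real.sin α) • b 2))) :
    dist a.fst (O - (r * Real.sin α) • b 2) = r ∧
      dist a.fst (O + (r * Real.sin α) • b 2) = r := by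
  obtain ⟨⟨hl₁, hl₂⟩, h⟩ := (mem_frontier_lens b O hr).1 ha.1
  rcases h with h | h
  · refine ⟨h, ?_⟩
    by_contra hne
    refine h₁ (eq_smul_of_mem_normalCone hr h ha.2 fun v hv => ?_)
    exact (eventually_mem_closedBall_of_inner_neg hl₁ fun _ => hv).and
      (eventually_mem_closedBall_of_inner_neg hl₂ fun h' => absurd h' hne)
  · refine ⟨?_, h⟩
    by_contra hne
    refine h₂ (eq_smul_of_mem_normalCone hr h ha.2 fun v hv => ?_)
    exact (eventually_mem_closedBall_of_inner_neg hl₁ fun h' => absurd h' hne).and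
      (eventually_mem_closedBall_of_inner_neg hl₂ fun _ => hv)

end NormalCone

/-! ### Oriented tangent planes -/

section Pairing

/-- Bilinearity and antisymmetry leave only the determinant of the coefficients; this compares two
frames of one tangent plane. -/
theorem twoForm_linear_combination (φ : TwoForm) (p q r s : ℝ) (x y : Total) :
    φ ![p • x + q • y, r • x + s • y] = (p * s - q * r) * φ ![x, y] := by
  have hswap : ∀ v w : Total, φ ![v, w] = -φ ![w, v] := by
    intro v w
    have h := φ.map_swap ![w, v] (show (0 : Fin 2) ≠ 1 by decide)
    rw [← h]
    congr 1
    ext i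
    fin_cases i <;> rfl
  have hself : ∀ v : Total, φ ![v, v] = 0 := fun v =>
    φ.map_eq_zero_of_eq ![v, v] (i := 0) (j := 1) rfl (by decide)
  have hl : ∀ (c d : ℝ) (v w z : Total),
      φ ![c • v + d • w, z] = c * φ ![v, z] + d * φ ![w, z] := by
    intro c d v w z
    rw [φ.map_vecCons_add, φ.map_vecCons_smul, φ.map_vecCons_smul]
    rfl
  have hr : ∀ (c d : ℝ) (v w z : Total),
      φ ![z, c • v + d • w] = c * φ ![z, v] + d * φ ![z, w] := by
    intro c d v w z
    rw [hswap, hl, hswap v z, hswap w z]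
    ring
  rw [hl, hr, hr, hself, hself, hswap y x]
  ring

theorem cross_linear_combination (p q r s : ℝ) (x y : Space) :
    cross (p • x + q • y) (r • x + s • y) = (p * s - q * r) • cross x y := by
  simp only [cross_add_left, cross_add_right, cross_smul_left, cross_smul_right, cross_same,
    cross_swap y x]
  module

theorem eq_vecCons_pair {T : Type*} (τ : Fin 2 → T) : τ = ![τ 0, τ 1] := by
  ext i
  fin_cases i <;> rfl

/-- Two direct orthonormal frames of the same tangent plane have the same exterior product. -/
theorem IsDirectTangentFrame.apply_eq {K : Set Space} {a : Total} {τ τ' : Fin 2 → Total}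
    (h : IsDirectTangentFrame K a τ) (h' : IsDirectTangentFrame K a τ') (φ : TwoForm) :
    φ τ' = φ τ := by
  have hspan : Submodule.span ℝ (range τ') = Submodule.span ℝ (range τ) :=
    SetLike.coe_injective (h'.span_eq.trans h.span_eq.symm)
  have hmem : ∀ i, ∃ p q : ℝ, p • τ 0 + q • τ 1 = τ' i := by
    intro i
    have hi : τ' i ∈ Submodule.span ℝ (range τ) := by
      rw [← hspan]
      exact Submodule.subset_span ⟨i, rfl⟩
    rw [eq_vecCons_pair τ, Matrix.range_cons_cons_empty, Submodule.mem_span_pair] at hi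
    exact hi
  obtain ⟨p, q, hpq⟩ := hmem 0
  obtain ⟨r, s, hrs⟩ := hmem 1
  have e00 : inner ℝ (τ 0) (τ 0) = (1 : ℝ) := by
    rw [real_inner_self_eq_norm_sq, h.orthonormal.1, one_pow]
  have e11 : inner ℝ (τ 1) (τ 1) = (1 : ℝ) := by
    rw [real_inner_self_eq_norm_sq, h.orthonormal.1, one_pow]
  have e01 : inner ℝ (τ 0) (τ 1) = (0 : ℝ) := h.orthonormal.2 (by decide)
  have e10 : inner ℝ (τ 1) (τ 0) = (0 : ℝ) := h.orthonormal.2 (by decide)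
  have f00 : inner ℝ (τ' 0) (τ' 0) = (1 : ℝ) := by
    rw [real_inner_self_eq_norm_sq, h'.orthonormal.1, one_pow]
  have f11 : inner ℝ (τ' 1) (τ' 1) = (1 : ℝ) := by
    rw [real_inner_self_eq_norm_sq, h'.orthonormal.1, one_pow]
  have f01 : inner ℝ (τ' 0) (τ' 1) = (0 : ℝ) := h'.orthonormal.2 (by decide)
  simp only [← hpq, ← hrs, inner_add_left, inner_add_right, inner_smul_left, inner_smul_right,
    e00, e11, e01, e10, conj_trivial] at f00 f11 f01
  -- Both frames are orthonormal, so the change of basis is orthogonal; the computation is `(p² +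
  -- q²)(r² + s²) - (pr + qs)² = (ps - qr)²`.
  have hdet : (p * s - q * r) ^ 2 = 1 := by
    linear_combination (r ^ 2 + s ^ 2) * f00 + f11 - (p * r + q * s) * f01
  -- Pushing both frames forward at the single time `t = 1` fixes the sign of the determinant.
  have hpos : 0 < p * s - q * r := by
    have d := h.direct 1 one_pos
    have d' := h'.direct 1 one_pos
    have w0 : (τ' 0).fst + (1 : ℝ) • (τ' 0).snd =
        p • ((τ 0).fst + (1 : ℝ) • (τ 0).snd) + q • ((τ 1).fst + (1 : ℝ) • (τ 1).snd) := by
      rw [← hpq]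
      simp only [WithLp.add_fst, WithLp.add_snd, WithLp.smul_fst, WithLp.smul_snd]
      module
    have w1 : (τ' 1).fst + (1 : ℝ) • (τ' 1).snd =
        r • ((τ 0).fst + (1 : ℝ) • (τ 0).snd) + s • ((τ 1).fst + (1 : ℝ) • (τ 1).snd) := by
      rw [← hrs]
      simp only [WithLp.add_fst, WithLp.add_snd, WithLp.smul_fst, WithLp.smul_snd]
      module
    rw [w0, w1, cross_linear_combination, inner_smul_left, conj_trivial] at d'
    exact pos_of_mul_pos_left d' d.le
  have hone : p * s - q * r = 1 := by
    rcases sq_eq_one_iff.1 hdet with h1 | h1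
    · exact h1
    · linarith
  rw [eq_vecCons_pair τ', ← hpq, ← hrs, twoForm_linear_combination, hone, one_mul,
    ← eq_vecCons_pair τ]

theorem IsDirectTangentFrame.orientedPairing_eq {K : Set Space} {a : Total} {τ : Fin 2 → Total}
    (h : IsDirectTangentFrame K a τ) (φ : TwoForm) : orientedPairing K a φ = φ τ := by
  have hex : ∃ τ, IsDirectTangentFrame K a τ := ⟨τ, h⟩
  rw [orientedPairing, dif_pos hex]
  exact h.apply_eq hex.choose_spec φ

end Pairing

/-! ### The tangent planes of the unit normal bundle of a lens along its edge -/

section TangentPlane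

/-- A function that vanishes on a set has a derivative that vanishes on its tangent cone. -/
theorem fderiv_eq_zero_of_mem_tangentConeAt {E : Type*} [NormedAddCommGroup E] [NormedSpace ℝ E]
    {s : Set E} {x v : E} {g : E → ℝ} {g' : E →L[ℝ] ℝ} (hg : HasFDerivAt g g' x)
    (hs : ∀ y ∈ s, g y = 0) (hx : x ∈ s) (hv : v ∈ tangentConeAt ℝ s x) : g' v = 0 := by
  have h0 : HasFDerivWithinAt g (0 : E →L[ℝ] ℝ) s x :=
    (hasFDerivWithinAt_const (0 : ℝ) x s).congr hs (hs x hx)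
  exact hg.hasFDerivWithinAt.unique_on h0 hv

variable (b : OrthonormalBasis (Fin 3) ℝ Space) (O : Space) {r α : ℝ}

/-- For `|θ| < α` the parametrization maps a whole open strip around `x` into the bundle, so every
value of its derivative is a tangent vector. -/
theorem mem_tangentConeAt_normalBundle_lens (hr : 0 < r) (hα : α ∈ Ioo 0 (Real.pi / 2))
    {x : EuclideanSpace ℝ (Fin 2)} (hx : x 1 ∈ Ioo (-α) α) (c d : ℝ) :
    c • bundleDerivZero b (r * Real.cos α) (x 0) (x 1) + d • bundleDerivOne b (x 0) (x 1) ∈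
      tangentConeAt ℝ (normalBundle (lens b O r α)) (bundlePoint b O (r * Real.cos α) x) := by
  have ho : {y : EuclideanSpace ℝ (Fin 2) | y 1 ∈ Ioo (-α) α} ∈ 𝓝 x :=
    (isOpen_Ioo.preimage (by fun_prop : Continuous fun y : EuclideanSpace ℝ (Fin 2) => y 1)).mem_nhds
      hx
  have hm := ((hasStrictFDerivAt_bundlePoint b O (r * Real.cos α) x).hasFDerivAt.hasFDerivWithinAt
    (s := {y : EuclideanSpace ℝ (Fin 2) | y 1 ∈ Ioo (-α) α})).mapsTo_tangent_cone
  rw [tangentConeAt_of_mem_nhds ho] at hm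
  have hv := hm (mem_univ !₂[c, d])
  rw [bundleFDeriv_apply] at hv
  refine tangentConeAt_mono ?_ hv
  rintro _ ⟨y, hy, rfl⟩
  exact bundlePoint_mem_normalBundle_lens b O hr hα ⟨hy.1.le, hy.2.le⟩

/-- The equations satisfied by the unit normal bundle above a circle. -/
theorem bundle_equations (hr : 0 < r) (hα : α ∈ Ioo 0 (Real.pi / 2)) {a : Total}
    (ha : a ∈ normalBundle (lens b O r α))
    (h₁ : dist a.fst (O - (r * Real.sin α) • b 2) = r)
    (h₂ : dist a.fst (O + (r * Real.sin α) • b 2) = r) :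
    inner ℝ (b 2) (a.fst - O) = 0 ∧
    inner ℝ (a.fst - O) (a.fst - O) - (r * Real.cos α) ^ 2 = 0 ∧
    inner ℝ a.snd a.snd - 1 = (0 : ℝ) ∧
    inner ℝ (b 0) (a.fst - O) * inner ℝ (b 1) a.snd -
      inner ℝ (b 1) (a.fst - O) * inner ℝ (b 0) a.snd = 0 := by
  obtain ⟨u, -, hu⟩ := exists_circlePoint_eq b O hr hα h₁ h₂
  have hn := ha.2
  rw [← hu] at hn
  obtain ⟨θ, -, hθ⟩ := (mem_normalCone_lens_iff b O hr hα u _).1 hn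
  have hsub : a.fst - O = (r * Real.cos α) • radial b u := by
    rw [← hu, circlePoint, add_sub_cancel_left]
  rw [hsub, ← hθ, (inner_latitude_frame b u θ).1]
  simp only [inner_smul_left, inner_smul_right, inner_radial_radial, conj_trivial,
    (inner_radial_frame b u).2.2.2.2.2.2.1]
  refine ⟨by simp, by ring, by simp, ?_⟩
  simp only [latitude, radial, inner_add_right, inner_smul_right, b.inner_eq_ite]
  simp
  ring

/-- This is the upper bound on the tangent cone: near a point with `|θ| < α` the bundle lies
entirely above the edge, and the four equations of `bundle_equations` can be differentiated along
it. -/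
theorem inner_eq_zero_of_mem_tangentConeAt (hr : 0 < r) (hα : α ∈ Ioo 0 (Real.pi / 2))
    {x : EuclideanSpace ℝ (Fin 2)} (hx : x 1 ∈ Ioo (-α) α) {v : Total}
    (hv : v ∈ tangentConeAt ℝ (normalBundle (lens b O r α))
      (bundlePoint b O (r * Real.cos α) x)) :
    inner ℝ (b 2) v.fst = 0 ∧ inner ℝ (radial b (x 0)) v.fst = 0 ∧
    inner ℝ (latitude b (x 0) (x 1)) v.snd = 0 ∧
    (r * Real.cos α) * inner ℝ (tangential b (x 0)) v.snd =
      Real.cos (x 1) * inner ℝ (tangential b (x 0)) v.fst := by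
  have hpi := Real.pi_pos
  have hc : 0 < Real.cos α := Real.cos_pos_of_mem_Ioo ⟨by linarith [hα.1], hα.2⟩
  set a := bundlePoint b O (r * Real.cos α) x with ha
  -- `W` removes the pairs whose normal is that of one of the spheres, which happens above the edge
  -- only for `θ = ±α`. It is an open neighbourhood of `a`, so intersecting with it leaves the
  -- tangent cone unchanged.
  let W : Set Total := {a | a.snd ≠ r⁻¹ • (a.fst - (O - (r * Real.sin α) • b 2))} ∩
    {a | a.snd ≠ r⁻¹ • (a.fst - (O + (r * Real.sin α) • b 2))}
  have hWo : IsOpen W := by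
    have c1 : Continuous fun a : Total => a.fst := WithLp.continuous_fst 2 Space Space
    have c2 : Continuous fun a : Total => a.snd := WithLp.continuous_snd 2 Space Space
    exact (isOpen_ne_fun c2 (by fun_prop)).inter (isOpen_ne_fun c2 (by fun_prop))
  have hsin : ∀ θ φ, latitude b (x 0) θ = latitude b (x 0) φ → Real.sin θ = Real.sin φ := by
    intro θ φ h
    rw [← inner_two_latitude b (x 0), h, inner_two_latitude]
  have hmem : a ∈ normalBundle (lens b O r α) :=
    bundlePoint_mem_normalBundle_lens b O hr hα ⟨hx.1.le, hx.2.le⟩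
  have haW : a ∈ W := by
    constructor
    · intro h
      change latitude b (x 0) (x 1) = r⁻¹ • (circlePoint b O (r * Real.cos α) (x 0) - _) at h
      rw [circlePoint_sub_sub, inv_smul_smul₀ hr.ne'] at h
      have := Real.injOn_sin ⟨by linarith [hx.1, hα.2], by linarith [hx.2, hα.2]⟩
        ⟨by linarith [hα.1], hα.2.le⟩ (hsin _ _ h)
      linarith [hx.2]
    · intro h
      change latitude b (x 0) (x 1) = r⁻¹ • (circlePoint b O (r * Real.cos α) (x 0) - _) at h
      rw [circlePoint_sub_add, inv_smul_smul₀ hr.ne'] at h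
      have := Real.injOn_sin ⟨by linarith [hx.1, hα.2], by linarith [hx.2, hα.2]⟩
        ⟨by linarith [hα.2], by linarith [hα.1]⟩ (hsin _ _ h)
      linarith [hx.1]
  rw [← tangentConeAt_inter_nhds (hWo.mem_nhds haW)] at hv
  have heq : ∀ y ∈ normalBundle (lens b O r α) ∩ W, _ := fun y hy =>
    have hd := dist_eq_of_mem_normalBundle_lens b O hr hy.1 hy.2.1 hy.2.2
    bundle_equations b O hr hα hy.1 hd.1 hd.2
  let F := WithLp.fstL 2 ℝ Space Space
  let S := WithLp.sndL 2 ℝ Space Space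
  have dF : HasFDerivAt (fun y : Total => y.fst - O) F a := F.hasFDerivAt.sub_const O
  have dS : HasFDerivAt (fun y : Total => y.snd) S a := S.hasFDerivAt
  have dI : ∀ (w : Space) (G : Total → Space) (G' : Total →L[ℝ] Space), HasFDerivAt G G' a →
      HasFDerivAt (fun y => inner ℝ w (G y)) ((innerSL ℝ w).comp G') a := fun w G G' hG =>
    (innerSL ℝ w).hasFDerivAt.comp a hG
  have k1 := fderiv_eq_zero_of_mem_tangentConeAt (dI (b 2) _ _ dF) (fun y hy => (heq y hy).1)
    ⟨hmem, haW⟩ hv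
  have k2 := fderiv_eq_zero_of_mem_tangentConeAt ((dF.inner ℝ dF).sub_const _)
    (fun y hy => (heq y hy).2.1) ⟨hmem, haW⟩ hv
  have k3 := fderiv_eq_zero_of_mem_tangentConeAt ((dS.inner ℝ dS).sub_const _)
    (fun y hy => (heq y hy).2.2.1) ⟨hmem, haW⟩ hv
  have k4 := fderiv_eq_zero_of_mem_tangentConeAt
    (((dI (b 0) _ _ dF).mul (dI (b 1) _ _ dS)).sub ((dI (b 1) _ _ dF).mul (dI (b 0) _ _ dS)))
    (fun y hy => (heq y hy).2.2.2) ⟨hmem, haW⟩ hv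
  have hafst : a.fst - O = (r * Real.cos α) • radial b (x 0) := by
    rw [ha]
    exact add_sub_cancel_left _ _
  have hasnd : a.snd = latitude b (x 0) (x 1) := rfl
  have hFv : F v = v.fst := rfl
  have hSv : S v = v.snd := rfl
  simp [hafst, hasnd, hFv, hSv, fderivInnerCLM_apply] at k1 k2 k3 k4
  have r0 : inner ℝ (b 0) (radial b (x 0)) = Real.cos (x 0) := by
    simp [radial, inner_add_right, inner_smul_right, b.inner_eq_ite]
  have r1 : inner ℝ (b 1) (radial b (x 0)) = Real.sin (x 0) := by
    simp [radial, inner_add_right, inner_smul_right, b.inner_eq_ite]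
  have l0 : inner ℝ (b 0) (latitude b (x 0) (x 1)) = Real.cos (x 1) * Real.cos (x 0) := by
    simp [latitude, inner_add_right, inner_smul_right, b.inner_eq_ite, r0]
  have l1 : inner ℝ (b 1) (latitude b (x 0) (x 1)) = Real.cos (x 1) * Real.sin (x 0) := by
    simp [latitude, inner_add_right, inner_smul_right, b.inner_eq_ite, r1]
  rw [real_inner_comm _ v.fst, inner_smul_left, conj_trivial] at k2
  rw [real_inner_comm _ v.snd] at k3
  rw [inner_smul_right, inner_smul_right, r0, r1, l0, l1] at k4
  have hρ : 0 < r * Real.cos α := mul_pos hr hc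
  refine ⟨k1, ?_, by linarith, ?_⟩
  · exact (mul_eq_zero.1 (show (r * Real.cos α) * _ = (0 : ℝ) by linarith)).resolve_left hρ.ne'
  · simp only [tangential, inner_add_left, inner_smul_left, conj_trivial]
    linear_combination k4

/-- The direct orthonormal frame of the unit normal bundle of a lens along its edge. -/
def lensFrame (r α u θ : ℝ) : Fin 2 → Total :=
  ![(√((r * Real.cos α) ^ 2 + Real.cos θ ^ 2))⁻¹ • bundleDerivZero b (r * Real.cos α) u θ,
    bundleDerivOne b u θ]

variable {b} in
theorem isDirectTangentFrame_lensFrame (hb : IsRightHanded b) (hr : 0 < r)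
    (hα : α ∈ Ioo 0 (Real.pi / 2)) {x : EuclideanSpace ℝ (Fin 2)} (hx : x 1 ∈ Ioo (-α) α) :
    IsDirectTangentFrame (lens b O r α) (bundlePoint b O (r * Real.cos α) x)
      (lensFrame b r α (x 0) (x 1)) := by
  have hpi := Real.pi_pos
  have hc : 0 < Real.cos α := Real.cos_pos_of_mem_Ioo ⟨by linarith [hα.1], hα.2⟩
  have hc' : 0 < Real.cos (x 1) :=
    Real.cos_pos_of_mem_Ioo ⟨by linarith [hx.1, hα.2], by linarith [hx.2, hα.2]⟩
  have hρ : 0 < r * Real.cos α := mul_pos hr hc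
  set ρ := r * Real.cos α with hρdef
  have hq : 0 < ρ ^ 2 + Real.cos (x 1) ^ 2 := by positivity
  have hs : 0 < √(ρ ^ 2 + Real.cos (x 1) ^ 2) := Real.sqrt_pos.2 hq
  have hss := Real.mul_self_sqrt hq.le
  have i00 := inner_bundleDerivZero b ρ (x 0) (x 1)
  have i11 := inner_bundleDerivOne b (x 0) (x 1)
  have i01 := inner_bundleDerivZero_bundleDerivOne b ρ (x 0) (x 1)
  have i10 : inner ℝ (bundleDerivOne b (x 0) (x 1)) (bundleDerivZero b ρ (x 0) (x 1)) = 0 := by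
    rw [real_inner_comm, i01]
  unfold lensFrame
  rw [← hρdef]
  set s := √(ρ ^ 2 + Real.cos (x 1) ^ 2) with hsdef
  refine ⟨?_, ?_, ?_⟩
  · rw [orthonormal_iff_ite]
    intro i j
    fin_cases i <;> fin_cases j
    · simp only [Fin.zero_eta, Matrix.cons_val_zero, inner_smul_left, inner_smul_right, i00,
        conj_trivial, if_true, ← hss]
      field_simp
    · simp [inner_smul_left, i01]
    · simp [inner_smul_right, i10]
    · rw [if_pos rfl]
      exact i11
  · ext v
    rw [Matrix.range_cons_cons_empty, SetLike.mem_coe, Submodule.mem_span_pair]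
    constructor
    · rintro ⟨c, d, rfl⟩
      rw [smul_smul]
      exact mem_tangentConeAt_normalBundle_lens b O hr hα hx _ _
    · intro hv
      obtain ⟨h1, h2, h3, h4⟩ := inner_eq_zero_of_mem_tangentConeAt b O hr hα hx hv
      -- The factor `s` undoes the normalization of the first frame vector.
      refine ⟨s * (inner ℝ (tangential b (x 0)) v.fst / ρ),
        inner ℝ (colatitude b (x 0) (x 1)) v.snd, ?_⟩
      have e1 := radial_expansion b (x 0) v.fst
      have e2 := latitude_expansion b (x 0) (x 1) v.snd
      rw [h1, h2, zero_smul, zero_smul, zero_add, add_zero] at e1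
      have h5 : inner ℝ (tangential b (x 0)) v.snd =
          inner ℝ (tangential b (x 0)) v.fst / ρ * Real.cos (x 1) := by
        rw [div_mul_eq_mul_div, eq_div_iff hρ.ne']
        linarith
      rw [h3, h5, zero_smul, zero_add] at e2
      have hsm : s * (inner ℝ (tangential b (x 0)) v.fst / ρ) * s⁻¹ =
          inner ℝ (tangential b (x 0)) v.fst / ρ := by field_simp
      rw [smul_smul, hsm]
      apply (WithLp.prodContinuousLinearEquiv 2 ℝ Space Space).injective
      ext1
      · change (inner ℝ (tangential b (x 0)) v.fst / ρ) • (ρ • tangential b (x 0)) +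
          (inner ℝ (colatitude b (x 0) (x 1)) v.snd) • (0 : Space) = v.fst
        rw [smul_zero, add_zero, smul_smul, div_mul_cancel₀ _ hρ.ne', ← e1]
      · change (inner ℝ (tangential b (x 0)) v.fst / ρ) • (Real.cos (x 1) • tangential b (x 0)) +
          (inner ℝ (colatitude b (x 0) (x 1)) v.snd) • colatitude b (x 0) (x 1) = v.snd
        rw [smul_smul, ← e2]
  -- The cross product of the pushed-forward vectors is `s⁻¹ t (ρ + t cos θ)` times the normal, and
  -- `cos θ > 0`.
  · intro t ht
    change 0 < inner ℝ (cross (s⁻¹ • (ρ • tangential b (x 0)) +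
      t • (s⁻¹ • (Real.cos (x 1) • tangential b (x 0)))) (0 + t • colatitude b (x 0) (x 1)))
      (latitude b (x 0) (x 1))
    simp only [zero_add, cross_add_left, cross_smul_left, cross_smul_right,
      hb.cross_tangential_colatitude, inner_add_left, inner_smul_left, conj_trivial,
      (inner_latitude_frame b (x 0) (x 1)).1]
    positivity

variable {b} in
/-- The density of the oriented pairing in the parametrization of the normal bundle. -/
theorem normDet_mul_orientedPairing_lens (hb : IsRightHanded b) (hr : 0 < r)
    (hα : α ∈ Ioo 0 (Real.pi / 2)) {x : EuclideanSpace ℝ (Fin 2)} (hx : x 1 ∈ Ioo (-α) α)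
    (φ : TwoForm) :
    (bundleFDeriv b (r * Real.cos α) x).toLinearMap.normDet *
      orientedPairing (lens b O r α) (bundlePoint b O (r * Real.cos α) x) φ =
      φ ![bundleDerivZero b (r * Real.cos α) (x 0) (x 1), bundleDerivOne b (x 0) (x 1)] := by
  have hpi := Real.pi_pos
  have hc : 0 < Real.cos α := Real.cos_pos_of_mem_Ioo ⟨by linarith [hα.1], hα.2⟩
  have hs : 0 < √((r * Real.cos α) ^ 2 + Real.cos (x 1) ^ 2) := by positivity
  -- The Jacobian equals the norm of the first partial derivative, so it cancels the factor that
  -- makes the frame orthonormal.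
  rw [(isDirectTangentFrame_lensFrame O hb hr hα hx).orientedPairing_eq, normDet_bundleFDeriv,
    lensFrame, φ.map_vecCons_smul, smul_eq_mul, mul_inv_cancel_left₀ hs.ne']

end TangentPlane

/-! ### Normal cycles above a part of the edge of a lens -/

section Cycles

/-- The plane as a product of lines. -/
def planeEquiv : EuclideanSpace ℝ (Fin 2) ≃ᵐ ℝ × ℝ :=
  (MeasurableEquiv.toLp 2 (Fin 2 → ℝ)).symm.trans MeasurableEquiv.finTwoArrow

theorem measurePreserving_planeEquiv : MeasurePreserving planeEquiv :=
  (EuclideanSpace.volume_preserving_symm_measurableEquiv_toLp (Fin 2)).trans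
    (volume_preserving_finTwoArrow ℝ)

variable (b : OrthonormalBasis (Fin 3) ℝ Space) (O : Space) {r α : ℝ}

/-- The set of parameters in a full turn of the points of the circle that lie in `A`. -/
def circleParam (ρ : ℝ) (A : Set Space) : Set ℝ :=
  Ioc 0 (2 * Real.pi) ∩ circlePoint b O ρ ⁻¹' A

theorem continuous_circlePoint (ρ : ℝ) : Continuous (circlePoint b O ρ) := by
  have := continuous_radial b
  unfold circlePoint
  fun_prop

theorem measurableSet_circleParam (ρ : ℝ) {A : Set Space} (hA : MeasurableSet A) :
    MeasurableSet (circleParam b O ρ A) :=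
  measurableSet_Ioc.inter ((continuous_circlePoint b O ρ).measurable hA)

theorem integrableOn_prod_Icc {F : ℝ × ℝ → ℝ} (hF : Continuous F) {T : Set ℝ} {R α : ℝ}
    (hT : T ⊆ Ioc 0 R) : IntegrableOn F (T ×ˢ Icc (-α) α) := by
  have : IntegrableOn F (Icc 0 R ×ˢ Icc (-α) α) :=
    hF.continuousOn.integrableOn_compact (isCompact_Icc.prod isCompact_Icc)
  exact this.mono_set (prod_mono (hT.trans Ioc_subset_Icc_self) Subset.rfl)

variable {b} in
/-- The normal cycle of a lens above a part of its edge. -/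
theorem convexNormalCycle_lens (hb : IsRightHanded b) (hr : 0 < r)
    (hα : α ∈ Ioo 0 (Real.pi / 2)) {A : Set Space} (hAm : MeasurableSet A)
    (hA : A ⊆ Metric.sphere (O - (r * Real.sin α) • b 2) r ∩
      Metric.sphere (O + (r * Real.sin α) • b 2) r)
    (φ : Total → TwoForm) {F : ℝ × ℝ → ℝ} (hF : Continuous F)
    (hφ : ∀ x : EuclideanSpace ℝ (Fin 2), φ (bundlePoint b O (r * Real.cos α) x)
      ![bundleDerivZero b (r * Real.cos α) (x 0) (x 1), bundleDerivOne b (x 0) (x 1)] =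
        F (x 0, x 1)) :
    IntegrableOn (fun a => orientedPairing (lens b O r α) a (φ a))
      (normalBundle (lens b O r α) ∩ above A) μHE[2] ∧
    convexNormalCycle (lens b O r α) A φ =
      ∫ p in circleParam b O (r * Real.cos α) A ×ˢ Icc (-α) α, F p := by
  have hpi := Real.pi_pos
  have hc : 0 < Real.cos α := Real.cos_pos_of_mem_Ioo ⟨by linarith [hα.1], hα.2⟩
  set ρ := r * Real.cos α with hρdef
  have hρ : 0 < ρ := mul_pos hr hc
  set T := circleParam b O ρ A with hT
  have hTm : MeasurableSet T := measurableSet_circleParam b O ρ hAm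
  have hset : {x : EuclideanSpace ℝ (Fin 2) | (x 0 ∈ Ioc 0 (2 * Real.pi) ∧
      circlePoint b O ρ (x 0) ∈ A) ∧ x 1 ∈ Icc (-α) α} =
      planeEquiv ⁻¹' (T ×ˢ Icc (-α) α) := rfl
  have hSm : MeasurableSet (planeEquiv ⁻¹' (T ×ˢ Icc (-α) α)) :=
    planeEquiv.measurable (hTm.prod measurableSet_Icc)
  have hinj : InjOn (bundlePoint b O ρ) (planeEquiv ⁻¹' (T ×ˢ Icc (-α) α)) := by
    refine (bundlePoint_injOn b O hρ.ne').mono ?_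
    rintro x ⟨hx0, hx1⟩
    have hx1' : x 1 ∈ Icc (-α) α := hx1
    exact ⟨hx0.1, ⟨by linarith [hx1'.1, hα.2], by linarith [hx1'.2, hα.2]⟩⟩
  set g := fun a => orientedPairing (lens b O r α) a (φ a) with hg
  have hint := integrableOn_image_iff_integrableOn_normDet_mul hSm
    (fun x _ => hasStrictFDerivAt_bundlePoint b O ρ x) (fun x _ => bundleFDeriv_injective b hρ x)
    (continuous_normDet_bundleFDeriv b ρ).continuousOn hinj g
  have heq := integral_image_eq_integral_normDet_mul hSm
    (fun x _ => hasStrictFDerivAt_bundlePoint b O ρ x) (fun x _ => bundleFDeriv_injective b hρ x)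
    (continuous_normDet_bundleFDeriv b ρ).continuousOn hinj g
  rw [finrank_euclideanSpace_fin] at hint heq
  have hae : ∀ᵐ x ∂volume.restrict (planeEquiv ⁻¹' (T ×ˢ Icc (-α) α)),
      (bundleFDeriv b ρ x).toLinearMap.normDet * g (bundlePoint b O ρ x) = F (planeEquiv x) := by
    -- The tangent frame is known only for `|θ| < α`; the two extreme latitudes form a null set of
    -- parameters.
    have hne : ∀ᵐ p : ℝ × ℝ, p.2 ≠ -α ∧ p.2 ≠ α :=
      Measure.quasiMeasurePreserving_snd.ae
        ((Measure.ae_ne volume (-α)).and (Measure.ae_ne volume α))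
    rw [ae_restrict_iff' hSm]
    filter_upwards [measurePreserving_planeEquiv.quasiMeasurePreserving.ae hne] with x hx hxS
    have hx1 : x 1 ∈ Ioo (-α) α :=
      ⟨lt_of_le_of_ne hxS.2.1 (Ne.symm hx.1), lt_of_le_of_ne hxS.2.2 hx.2⟩
    rw [hg]
    exact (normDet_mul_orientedPairing_lens O hb hr hα hx1 _).trans (hφ x)
  rw [convexNormalCycle, normalBundle_lens_inter_above b O hr hα hA, ← hρdef, hset, hint, heq,
    integral_congr_ae hae]
  refine ⟨?_, measurePreserving_planeEquiv.setIntegral_preimage_emb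
    planeEquiv.measurableEmbedding F _⟩
  refine Integrable.congr (f := F ∘ planeEquiv) ?_ (hae.mono fun x hx => hx.symm)
  exact (measurePreserving_planeEquiv.integrableOn_comp_preimage
    planeEquiv.measurableEmbedding).2 (integrableOn_prod_Icc hF inter_subset_left)

theorem setIntegral_prod_Icc_of_ae_eq {F : ℝ × ℝ → ℝ} (hF : Continuous F) {T : Set ℝ} {β : ℝ}
    (hβ : 0 ≤ β) (hα : 0 ≤ α) (hT : T =ᵐ[volume] Ioc 0 β) :
    ∫ p in T ×ˢ Icc (-α) α, F p = ∫ u in 0..β, ∫ θ in -α..α, F (u, θ) := by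
  have h1 : T ×ˢ Icc (-α) α =ᵐ[volume] Ioc 0 β ×ˢ Ioc (-α) α :=
    Measure.set_prod_ae_eq hT Ioc_ae_eq_Icc.symm
  have h2 : IntegrableOn F (Ioc 0 β ×ˢ Ioc (-α) α) :=
    (integrableOn_prod_Icc hF (R := β) Subset.rfl).mono_set
      (prod_mono Subset.rfl Ioc_subset_Icc_self)
  rw [setIntegral_congr_set h1, Measure.volume_eq_prod, setIntegral_prod _ h2,
    intervalIntegral.integral_of_le hβ]
  congr 1
  ext u
  rw [intervalIntegral.integral_of_le (by linarith)]

theorem contDiff_radial {n : WithTop ℕ∞} : ContDiff ℝ n (radial b) := by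
  unfold radial
  exact (Real.contDiff_cos.smul contDiff_const).add (Real.contDiff_sin.smul contDiff_const)

/-- The normal bundle of a ball above a circle is a curve. -/
theorem euclideanHausdorffMeasure_normalBundle_closedBall (hr : 0 < r) (ρ : ℝ) (c : Space)
    {A : Set Space} (hA : A ⊆ range (circlePoint b O ρ)) :
    μHE[2] (normalBundle (Metric.closedBall c r) ∩ above A) = 0 := by
  have hc : ContDiff ℝ 1 fun u => (WithLp.toLp 2
      (circlePoint b O ρ u, r⁻¹ • (circlePoint b O ρ u - c)) : Total) := by
    have h1 : ContDiff ℝ 1 (circlePoint b O ρ) :=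
      contDiff_const.add ((contDiff_radial b).const_smul ρ)
    exact (WithLp.prodContinuousLinearEquiv 2 ℝ Space Space).symm.contDiff.comp
      (h1.prodMk ((h1.sub contDiff_const).const_smul r⁻¹))
  refine measure_mono_null ?_ (euclideanHausdorffMeasure_two_range_eq_zero hc)
  rintro a ⟨ha, haA⟩
  obtain ⟨u, hu⟩ := hA haA
  refine ⟨u, ?_⟩
  apply (WithLp.prodContinuousLinearEquiv 2 ℝ Space Space).injective
  ext1
  · exact hu
  · change r⁻¹ • (circlePoint b O ρ u - c) = a.snd
    rw [mem_normalBundle_closedBall hr ha, hu]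

end Cycles

/-! ### Unions of two sets -/

section Union

variable (K₀ K₁ A : Set Space) (φ : Total → TwoForm)

theorem biInter_pair : ⋂ i ∈ ({0, 1} : Finset (Fin 2)), ![K₀, K₁] i = K₀ ∩ K₁ := by
  simp

theorem unionNormalCycle_pair : unionNormalCycle ![K₀, K₁] A φ =
    convexNormalCycle K₀ A φ + convexNormalCycle K₁ A φ - convexNormalCycle (K₀ ∩ K₁) A φ := by
  have hs : (Finset.univ.filter fun s : Finset (Fin 2) => s.Nonempty) =
      {{0}, {1}, {0, 1}} := by decide
  rw [unionNormalCycle, hs, Finset.sum_insert (by decide), Finset.sum_insert (by decide),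
    Finset.sum_singleton, biInter_pair]
  simp
  ring

theorem unionNormalCycleConverges_pair : UnionNormalCycleConverges ![K₀, K₁] A φ ↔
    IntegrableOn (fun a => orientedPairing K₀ a (φ a)) (normalBundle K₀ ∩ above A) μHE[2] ∧
    IntegrableOn (fun a => orientedPairing K₁ a (φ a)) (normalBundle K₁ ∩ above A) μHE[2] ∧
    IntegrableOn (fun a => orientedPairing (K₀ ∩ K₁) a (φ a))
      (normalBundle (K₀ ∩ K₁) ∩ above A) μHE[2] := by
  have hs : ∀ s : Finset (Fin 2), s.Nonempty ↔ s = {0} ∨ s = {1} ∨ s = {0, 1} := by decide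
  simp only [UnionNormalCycleConverges, hs, forall_eq_or_imp, forall_eq, biInter_pair]
  simp

end Union

/-! ### The curvature forms in the parametrization -/

section Forms

variable {b : OrthonormalBasis (Fin 3) ℝ Space} (O : Space) (ρ : ℝ) (X Y : Space)

/-- The second partial derivative has no base component, so one term of the wedge vanishes. The
other is computed by rotating the triple product: `⟨ξ × X, t⟩ = ⟨t × ξ, X⟩ = -⟨e, X⟩`. -/
theorem omegaForm_bundle (hb : IsRightHanded b) (x : EuclideanSpace ℝ (Fin 2)) :
    omegaForm X Y (bundlePoint b O ρ x)
      ![bundleDerivZero b ρ (x 0) (x 1), bundleDerivOne b (x 0) (x 1)] =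
    ρ * (inner ℝ (colatitude b (x 0) (x 1)) X * inner ℝ (colatitude b (x 0) (x 1)) Y) := by
  have h : inner ℝ (cross (latitude b (x 0) (x 1)) X) (tangential b (x 0)) =
      -inner ℝ (colatitude b (x 0) (x 1)) X := by
    rw [← inner_cross_rotate, hb.cross_tangential_latitude, inner_neg_left]
  rw [omegaForm, wedge_apply]
  simp only [Matrix.cons_val_zero, Matrix.cons_val_one, WithLp.prod_inner_apply, bundlePoint, WithLp.toLp_snd,
    bundleDerivZero, bundleDerivOne, inner_zero_left, inner_zero_right, inner_smul_right, h]
  rw [real_inner_comm (colatitude b (x 0) (x 1)) Y]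
  ring

/-- Again only one term of the wedge survives, with `⟨ξ × Y, e⟩ = ⟨e × ξ, Y⟩ = ⟨t, Y⟩`. -/
theorem omegaTildeForm_bundle (hb : IsRightHanded b) (x : EuclideanSpace ℝ (Fin 2)) :
    omegaTildeForm X Y (bundlePoint b O ρ x)
      ![bundleDerivZero b ρ (x 0) (x 1), bundleDerivOne b (x 0) (x 1)] =
    ρ * (inner ℝ (tangential b (x 0)) X * inner ℝ (tangential b (x 0)) Y) := by
  have h : inner ℝ (cross (latitude b (x 0) (x 1)) Y) (colatitude b (x 0) (x 1)) =
      inner ℝ (tangential b (x 0)) Y := by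
    rw [← inner_cross_rotate, hb.cross_colatitude_latitude]
  rw [omegaTildeForm, wedge_apply]
  simp only [Matrix.cons_val_zero, Matrix.cons_val_one, WithLp.prod_inner_apply, bundlePoint, WithLp.toLp_snd,
    bundleDerivZero, bundleDerivOne, inner_zero_left, inner_zero_right, inner_smul_right, h]
  rw [real_inner_comm _ X]
  ring

end Forms

/-! ### The integrals -/

section Integrals

/-- The mixed products have an even primitive, a multiple of `sin² θ`, and drop out over the
symmetric interval. Hence no entry of the first matrix couples the axis with the plane of the
circle. -/
theorem integral_colatitude (α p q p' q' : ℝ) :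
    ∫ θ in -α..α, (-Real.sin θ * p + Real.cos θ * q) * (-Real.sin θ * p' + Real.cos θ * q') =
      (α - Real.sin (2 * α) / 2) * (p * p') + (α + Real.sin (2 * α) / 2) * (q * q') := by
  have hd : ∀ θ ∈ uIcc (-α) α, HasDerivAt (fun θ => (θ - Real.sin θ * Real.cos θ) / 2 * (p * p') +
      (θ + Real.sin θ * Real.cos θ) / 2 * (q * q') - Real.sin θ ^ 2 / 2 * (p * q' + q * p'))
      ((-Real.sin θ * p + Real.cos θ * q) * (-Real.sin θ * p' + Real.cos θ * q')) θ := by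
    intro θ _
    have hs := Real.hasDerivAt_sin θ
    have hsc := hs.mul (Real.hasDerivAt_cos θ)
    have hi := hasDerivAt_id θ
    have h := ((((hi.sub hsc).div_const 2).mul_const (p * p')).add
      (((hi.add hsc).div_const 2).mul_const (q * q'))).sub
      (((hs.pow 2).div_const 2).mul_const (p * q' + q * p'))
    refine h.congr_deriv ?_
    have := Real.sin_sq_add_cos_sq θ
    simp
    linear_combination (-(p * p') / 2 - q * q' / 2) * this
  rw [intervalIntegral.integral_eq_sub_of_hasDerivAt hd
    (Continuous.intervalIntegrable (by fun_prop) _ _)]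
  simp only [Real.sin_neg, Real.cos_neg, Real.sin_two_mul]
  ring

theorem integral_radial (β S p q p' q' : ℝ) :
    ∫ u in 0..β, (S * ((Real.cos u * p + Real.sin u * q) * (Real.cos u * p' + Real.sin u * q'))) =
      S * (1 / 2 * (β + Real.sin (2 * β) / 2) * (p * p') +
        (1 - Real.cos (2 * β)) / 4 * (p * q' + q * p') +
        1 / 2 * (β - Real.sin (2 * β) / 2) * (q * q')) := by
  have hd : ∀ u ∈ uIcc 0 β, HasDerivAt (fun u => S * ((u + Real.sin u * Real.cos u) / 2 * (p * p') +
      (u - Real.sin u * Real.cos u) / 2 * (q * q') + Real.sin u ^ 2 / 2 * (p * q' + q * p')))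
      (S * ((Real.cos u * p + Real.sin u * q) * (Real.cos u * p' + Real.sin u * q'))) u := by
    intro u _
    have hs := Real.hasDerivAt_sin u
    have hsc := hs.mul (Real.hasDerivAt_cos u)
    have hi := hasDerivAt_id u
    have h := (((((hi.add hsc).div_const 2).mul_const (p * p')).add
      (((hi.sub hsc).div_const 2).mul_const (q * q'))).add
      (((hs.pow 2).div_const 2).mul_const (p * q' + q * p'))).const_mul S
    refine h.congr_deriv ?_
    have := Real.sin_sq_add_cos_sq u
    refine congrArg (S * ·) ?_
    simp
    linear_combination (-(p * p') / 2 - q * q' / 2) * this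
  rw [intervalIntegral.integral_eq_sub_of_hasDerivAt hd
    (Continuous.intervalIntegrable (by fun_prop) _ _)]
  have h2 := Real.cos_sq' β
  simp only [Real.sin_zero, Real.cos_zero, Real.sin_two_mul, Real.cos_two_mul]
  linear_combination (S * (p * q' + q * p') / 2) * h2

end Integrals

/-! ### Assembling the curvature measures -/

section Assembly

/-- An orthonormal basis can be made direct by changing the sign of its last vector. -/
theorem exists_isRightHanded (b : OrthonormalBasis (Fin 3) ℝ Space) :
    ∃ b' : OrthonormalBasis (Fin 3) ℝ Space, IsRightHanded b' ∧ b' 0 = b 0 ∧ b' 1 = b 1 ∧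
      (b' 2 = b 2 ∨ b' 2 = -b 2) := by
  rcases cross_frame_eq_or b with h | h
  · exact ⟨b, ⟨h⟩, rfl, rfl, Or.inl rfl⟩
  · have hon : Orthonormal ℝ ![b 0, b 1, -b 2] := by
      rw [orthonormal_iff_ite]
      intro i j
      fin_cases i <;> fin_cases j <;> simp [b.inner_eq_ite]
    have hsp : (Submodule.span ℝ (range ![b 0, b 1, -b 2]))ᗮ = ⊥ := by
      rw [Submodule.eq_bot_iff]
      intro v hv
      have hm : ∀ i, inner ℝ (![b 0, b 1, -b 2] i) v = 0 := fun i =>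
        (Submodule.mem_orthogonal _ v).1 hv _ (Submodule.subset_span ⟨i, rfl⟩)
      have h0 : inner ℝ (b 0) v = 0 := hm 0
      have h1 : inner ℝ (b 1) v = 0 := hm 1
      have h2 : inner ℝ (-b 2) v = 0 := hm 2
      rw [inner_neg_left, neg_eq_zero] at h2
      rw [frame_expansion b v, h0, h1, h2]
      simp
    refine ⟨OrthonormalBasis.mkOfOrthogonalEqBot hon hsp, ⟨?_⟩, ?_, ?_, Or.inr ?_⟩ <;>
      simp [h]

variable {b : OrthonormalBasis (Fin 3) ℝ Space} {O : Space} {r α β : ℝ} {A : Set Space}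

theorem inner_colatitude (u θ : ℝ) (v : Space) : inner ℝ (colatitude b u θ) v =
    -Real.sin θ * (Real.cos u * inner ℝ (b 0) v + Real.sin u * inner ℝ (b 1) v) +
      Real.cos θ * inner ℝ (b 2) v := by
  simp only [colatitude, radial, inner_add_left, inner_smul_left, conj_trivial]

theorem inner_tangential (u : ℝ) (v : Space) : inner ℝ (tangential b u) v =
    -Real.sin u * inner ℝ (b 0) v + Real.cos u * inner ℝ (b 1) v := by
  simp only [tangential, inner_add_left, inner_smul_left, conj_trivial]

theorem continuous_colatitude_coordinates (ρ : ℝ) (X Y : Space) : Continuous fun p : ℝ × ℝ =>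
    ρ * (inner ℝ (colatitude b p.1 p.2) X * inner ℝ (colatitude b p.1 p.2) Y) := by
  simp only [inner_colatitude]
  fun_prop

theorem continuous_tangential_coordinates (ρ : ℝ) (X Y : Space) : Continuous fun p : ℝ × ℝ =>
    ρ * (inner ℝ (tangential b p.1) X * inner ℝ (tangential b p.1) Y) := by
  simp only [inner_tangential]
  fun_prop

/-- The first anisotropic curvature measure of a lens above an arc of its edge. -/
theorem convexNormalCycle_lens_omegaForm (hb : IsRightHanded b) (hr : 0 < r)
    (hα : α ∈ Ioo 0 (Real.pi / 2)) (hAm : MeasurableSet A)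
    (hA : A ⊆ Metric.sphere (O - (r * Real.sin α) • b 2) r ∩
      Metric.sphere (O + (r * Real.sin α) • b 2) r)
    (hβ : 0 ≤ β) (hT : circleParam b O (r * Real.cos α) A =ᵐ[volume] Ioc 0 β) (X Y : Space) :
    IntegrableOn (fun a => orientedPairing (lens b O r α) a (omegaForm X Y a))
      (normalBundle (lens b O r α) ∩ above A) μHE[2] ∧
    convexNormalCycle (lens b O r α) A (omegaForm X Y) =
      -formOfMatrix b ((-(r * Real.cos α)) •
        !![1 / 2 * (α - Real.sin (2 * α) / 2) * (β + Real.sin (2 * β) / 2),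
            (α - Real.sin (2 * α) / 2) * ((1 - Real.cos (2 * β)) / 4), 0;
          (α - Real.sin (2 * α) / 2) * ((1 - Real.cos (2 * β)) / 4),
            1 / 2 * (α - Real.sin (2 * α) / 2) * (β - Real.sin (2 * β) / 2), 0;
          0, 0, β * (α + Real.sin (2 * α) / 2)]) X Y := by
  have hF := continuous_colatitude_coordinates (b := b) (r * Real.cos α) X Y
  obtain ⟨h1, h2⟩ := convexNormalCycle_lens O hb hr hα hAm hA (omegaForm X Y) hF
    fun x => omegaForm_bundle O _ X Y hb x
  refine ⟨h1, ?_⟩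
  rw [h2, setIntegral_prod_Icc_of_ae_eq hF hβ hα.1.le hT]
  simp only [intervalIntegral.integral_const_mul, inner_colatitude, integral_colatitude]
  rw [intervalIntegral.integral_add (Continuous.intervalIntegrable (by fun_prop) _ _)
    (Continuous.intervalIntegrable (by fun_prop) _ _), integral_radial,
    intervalIntegral.integral_const]
  simp only [formOfMatrix, Fin.sum_univ_three, Matrix.smul_apply, Matrix.of_apply,
    Matrix.cons_val, smul_eq_mul, mul_zero, zero_mul, add_zero, zero_add, sub_zero]
  ring

/-- The second anisotropic curvature measure of a lens above an arc of its edge. -/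
theorem convexNormalCycle_lens_omegaTildeForm (hb : IsRightHanded b) (hr : 0 < r)
    (hα : α ∈ Ioo 0 (Real.pi / 2)) (hAm : MeasurableSet A)
    (hA : A ⊆ Metric.sphere (O - (r * Real.sin α) • b 2) r ∩
      Metric.sphere (O + (r * Real.sin α) • b 2) r)
    (hβ : 0 ≤ β) (hT : circleParam b O (r * Real.cos α) A =ᵐ[volume] Ioc 0 β) (X Y : Space) :
    IntegrableOn (fun a => orientedPairing (lens b O r α) a (omegaTildeForm X Y a))
      (normalBundle (lens b O r α) ∩ above A) μHE[2] ∧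
    convexNormalCycle (lens b O r α) A (omegaTildeForm X Y) =
      -formOfMatrix b ((-(r * α * Real.cos α)) •
        !![β - Real.sin (2 * β) / 2, (Real.cos (2 * β) - 1) / 2, 0;
          (Real.cos (2 * β) - 1) / 2, β + Real.sin (2 * β) / 2, 0;
          0, 0, 0]) X Y := by
  have hF := continuous_tangential_coordinates (b := b) (r * Real.cos α) X Y
  obtain ⟨h1, h2⟩ := convexNormalCycle_lens O hb hr hα hAm hA (omegaTildeForm X Y) hF
    fun x => omegaTildeForm_bundle O _ X Y hb x
  refine ⟨h1, ?_⟩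
  rw [h2, setIntegral_prod_Icc_of_ae_eq hF hβ hα.1.le hT]
  -- The tangential vector is the radial one turned by a right angle, so the same integral applies
  -- to the coordinates `(⟨b 1, ·⟩, -⟨b 0, ·⟩)`. The integrand does not depend on `θ`, whence the
  -- factor `2α`.
  have hrad := integral_radial β (2 * α * (r * Real.cos α)) (inner ℝ (b 1) X) (-inner ℝ (b 0) X)
    (inner ℝ (b 1) Y) (-inner ℝ (b 0) Y)
  have hcongr : ∀ u : ℝ, ∫ θ in -α..α, r * Real.cos α *
      (inner ℝ (tangential b (u, θ).1) X * inner ℝ (tangential b (u, θ).1) Y) =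
      2 * α * (r * Real.cos α) *
        ((Real.cos u * inner ℝ (b 1) X + Real.sin u * -inner ℝ (b 0) X) *
        (Real.cos u * inner ℝ (b 1) Y + Real.sin u * -inner ℝ (b 0) Y)) := by
    intro u
    simp only [intervalIntegral.integral_const, inner_tangential, smul_eq_mul]
    ring
  simp only [hcongr, hrad]
  simp only [formOfMatrix, Fin.sum_univ_three, Matrix.smul_apply, Matrix.of_apply,
    Matrix.cons_val, smul_eq_mul, mul_zero, zero_mul, add_zero]
  ring

/-- The terms of the two balls are integrals over null sets, so both convergence and value are
decided by the intersection, which enters with sign `-1`. -/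
theorem unionNormalCycle_closedBalls {K₀ K₁ : Set Space} {c₀ c₁ : Space} (hr : 0 < r) {ρ : ℝ}
    (hK₀ : K₀ = Metric.closedBall c₀ r) (hK₁ : K₁ = Metric.closedBall c₁ r)
    (hA : A ⊆ range (circlePoint b O ρ)) {φ : Total → TwoForm} {K : Set Space} (hK : K₀ ∩ K₁ = K)
    {I : ℝ} (h : IntegrableOn (fun a => orientedPairing K a (φ a)) (normalBundle K ∩ above A) μHE[2]
      ∧ convexNormalCycle K A φ = -I) :
    UnionNormalCycleConverges ![K₀, K₁] A φ ∧ unionNormalCycle ![K₀, K₁] A φ = I := by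
  have hnull : ∀ c : Space, (μHE[2] : Measure Total).restrict
      (normalBundle (Metric.closedBall c r) ∩ above A) = 0 := fun c =>
    Measure.restrict_eq_zero.2 (euclideanHausdorffMeasure_normalBundle_closedBall b O hr ρ c hA)
  rw [unionNormalCycleConverges_pair, unionNormalCycle_pair, hK, h.2, hK₀, hK₁]
  simp only [IntegrableOn, convexNormalCycle, hnull]
  refine ⟨⟨integrable_zero_measure, integrable_zero_measure, h.1⟩, ?_⟩
  simp

/-- The vector `b 2` enters only through the product of the two axial coordinates, so changing its
sign has no effect. -/
theorem formOfMatrix_congr {b b' : OrthonormalBasis (Fin 3) ℝ Space} (h0 : b' 0 = b 0)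
    (h1 : b' 1 = b 1) (h2 : b' 2 = b 2 ∨ b' 2 = -b 2) (c m₀₀ m₀₁ m₁₀ m₁₁ m₂₂ : ℝ) (X Y : Space) :
    formOfMatrix b' (c • !![m₀₀, m₀₁, 0; m₁₀, m₁₁, 0; 0, 0, m₂₂]) X Y =
      formOfMatrix b (c • !![m₀₀, m₀₁, 0; m₁₀, m₁₁, 0; 0, 0, m₂₂]) X Y := by
  simp only [formOfMatrix, Fin.sum_univ_three, h0, h1]
  rcases h2 with h2 | h2 <;> simp [h2]

/-- The parameters of an arc, identified by its length. -/
theorem circleParam_ae_eq {ρ : ℝ} (hρ : 0 < ρ) {B C : Set Space} (hBC : MeasurableSet (B ∩ C))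
    (hβ : β = 2 * Real.pi * (μHE[1].real (B ∩ C) / μHE[1].real C))
    (harc : ∀ u ∈ Ioo 0 β, circlePoint b O ρ u ∈ B ∩ C)
    (hrange : circlePoint b O ρ '' Ioc 0 (2 * Real.pi) = C) :
    0 ≤ β ∧ circleParam b O ρ (B ∩ C) =ᵐ[volume] Ioc 0 β := by
  have hpi := Real.pi_pos
  have hTm := measurableSet_circleParam b O ρ hBC
  have hTsub : circleParam b O ρ (B ∩ C) ⊆ Ioc 0 (2 * Real.pi) := inter_subset_left
  have himg : circlePoint b O ρ '' circleParam b O ρ (B ∩ C) = B ∩ C := by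
    rw [circleParam, image_inter_preimage, hrange, inter_eq_right]
    exact inter_subset_right
  have hvol : volume (Ioc 0 (2 * Real.pi)) = ENNReal.ofReal (2 * Real.pi) := by simp
  have hle : volume (circleParam b O ρ (B ∩ C)) ≤ ENNReal.ofReal (2 * Real.pi) :=
    hvol ▸ measure_mono hTsub
  have hfin : volume (circleParam b O ρ (B ∩ C)) ≠ ∞ := (hle.trans_lt ENNReal.ofReal_lt_top).ne
  have h1 := euclideanHausdorffMeasure_circlePoint_image b O hρ hTm hTsub
  have h2 := euclideanHausdorffMeasure_circlePoint_image b O hρ measurableSet_Ioc Subset.rfl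
  rw [himg] at h1
  rw [hrange, hvol] at h2
  rw [Measure.real, Measure.real, h1, h2, ENNReal.toReal_mul, ENNReal.toReal_mul,
    ENNReal.toReal_ofReal hρ.le, ENNReal.toReal_ofReal (by positivity)] at hβ
  -- Arc length is `ρ` times parameter length, so `ρ` and `2π` cancel in the quotient of lengths.
  have hβ' : β = (volume (circleParam b O ρ (B ∩ C))).toReal := by
    rw [hβ]
    field_simp
  have hβ0 : 0 ≤ β := hβ' ▸ ENNReal.toReal_nonneg
  have hβ2 : β ≤ 2 * Real.pi := by
    rw [hβ']
    exact ENNReal.toReal_le_of_le_ofReal (by positivity) hle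
  have hsub : Ioo 0 β ⊆ circleParam b O ρ (B ∩ C) := fun u hu =>
    ⟨⟨hu.1, hu.2.le.trans hβ2⟩, harc u hu⟩
  refine ⟨hβ0, ?_⟩
  -- An inclusion between sets of equal finite measure is an equality almost everywhere.
  refine (ae_eq_of_subset_of_measure_ge hsub ?_ measurableSet_Ioo.nullMeasurableSet hfin).symm.trans
    Ioo_ae_eq_Ioc
  rw [Real.volume_Ioo, sub_zero, hβ', ENNReal.ofReal_toReal hfin]

theorem sphere_inter_sphere_eq_range (hr : 0 < r) (hα : α ∈ Ioo 0 (Real.pi / 2)) :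
    circlePoint b O (r * Real.cos α) '' Ioc 0 (2 * Real.pi) =
      Metric.sphere (O - (r * Real.sin α) • b 2) r ∩
        Metric.sphere (O + (r * Real.sin α) • b 2) r ∧
    Metric.sphere (O - (r * Real.sin α) • b 2) r ∩
      Metric.sphere (O + (r * Real.sin α) • b 2) r = range (circlePoint b O (r * Real.cos α)) := by
  have h1 : Metric.sphere (O - (r * Real.sin α) • b 2) r ∩
      Metric.sphere (O + (r * Real.sin α) • b 2) r ⊆
      circlePoint b O (r * Real.cos α) '' Ioc 0 (2 * Real.pi) := fun p hp =>
    exists_circlePoint_eq b O hr hα hp.1 hp.2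
  have h2 : range (circlePoint b O (r * Real.cos α)) ⊆
      Metric.sphere (O - (r * Real.sin α) • b 2) r ∩
        Metric.sphere (O + (r * Real.sin α) • b 2) r := by
    rintro _ ⟨u, rfl⟩
    exact ⟨dist_circlePoint_sub b O hr u, dist_circlePoint_add b O hr u⟩
  exact ⟨((image_subset_range _ _).trans h2).antisymm h1,
    (h1.trans (image_subset_range _ _)).antisymm h2⟩

/-- The centers of two balls in terms of a frame whose first two vectors are orthogonal to the
line of centers. -/
theorem centers_eq {A₁ A₂ : Space} (hr : 0 < r) (hint : dist A₁ A₂ < 2 * r)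
    (hα : α = Real.arcsin (dist A₁ A₂ / (2 * r)))
    (hi : inner ℝ (b 0) (A₂ - A₁) = 0) (hj : inner ℝ (b 1) (A₂ - A₁) = 0) :
    (A₁ = midpoint ℝ A₁ A₂ - (r * Real.sin α) • b 2 ∧
      A₂ = midpoint ℝ A₁ A₂ + (r * Real.sin α) • b 2) ∨
    (A₂ = midpoint ℝ A₁ A₂ - (r * Real.sin α) • b 2 ∧
      A₁ = midpoint ℝ A₁ A₂ + (r * Real.sin α) • b 2) := by
  have hd : dist A₁ A₂ / (2 * r) ≤ 1 := by
    rw [div_le_one (by positivity)]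
    exact hint.le
  have hd0 : 0 ≤ dist A₁ A₂ / (2 * r) := by positivity
  have hsin : r * Real.sin α = dist A₁ A₂ / 2 := by
    rw [hα, Real.sin_arcsin (by linarith) hd]
    field_simp
  have hexp := frame_expansion b (A₂ - A₁)
  rw [hi, hj, zero_smul, zero_smul, zero_add, zero_add] at hexp
  have hnorm : dist A₁ A₂ = |inner ℝ (b 2) (A₂ - A₁)| := by
    rw [dist_comm, dist_eq_norm]
    conv_lhs => rw [hexp, norm_smul, b.norm_eq_one, mul_one, Real.norm_eq_abs]
  have hmid : midpoint ℝ A₁ A₂ = (1 / 2 : ℝ) • A₁ + (1 / 2 : ℝ) • A₂ := by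
    rw [midpoint_eq_smul_add, smul_add]
    norm_num
  rw [hsin, hnorm, hmid]
  -- The axis `b 2` is determined only up to sign, so either center may lie on its positive side.
  rcases abs_choice (inner ℝ (b 2) (A₂ - A₁)) with h | h
  · left
    have e : (|inner ℝ (b 2) (A₂ - A₁)| / 2) • b 2 = (1 / 2 : ℝ) • (A₂ - A₁) := by
      conv_rhs => rw [hexp]
      rw [h]
      module
    rw [e]
    constructor <;> module
  · right
    have e : (|inner ℝ (b 2) (A₂ - A₁)| / 2) • b 2 = -(1 / 2 : ℝ) • (A₂ - A₁) := by
      conv_rhs => rw [hexp]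
      rw [h]
      module
    rw [e]
    constructor <;> module

end Assembly

end AnisotropicCurvature

end

/-! ### The curvature matrices of the union of two balls -/

theorem mainTheorem10 (r : ℝ) (hr : 0 < r) (A₁ A₂ : Space) (hne : A₁ ≠ A₂)
    (hint : dist A₁ A₂ < 2 * r)
    (C : Set Space) (hC : C = Metric.sphere A₁ r ∩ Metric.sphere A₂ r)
    (B : Set Space)
    (hB : ∃ (c : Space) (s : ℝ), B = Metric.closedBall c s ∨ B = Metric.ball c s)
    (α β : ℝ) (hα : α = Real.arcsin (dist A₁ A₂ / (2 * r)))
    (hβ : β = 2 * Real.pi * (μHE[1].real (B ∩ C) / μHE[1].real C))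
    (b : OrthonormalBasis (Fin 3) ℝ Space)
    (hi : inner ℝ (b 0) (A₂ - A₁) = 0) (hj : inner ℝ (b 1) (A₂ - A₁) = 0)
    -- up to its endpoints, the arc `B ∩ C` (of angle `β`) is swept from `i = b 0` towards `j = b 1`
    (harc : ∀ u ∈ Set.Ioo 0 β,
      midpoint ℝ A₁ A₂ + (r * Real.cos α) • (Real.cos u • b 0 + Real.sin u • b 1) ∈ B ∩ C) :
    (∀ X Y : Space,
      UnionNormalCycleConverges ![Metric.closedBall A₁ r, Metric.closedBall A₂ r] (B ∩ C)
        (omegaForm X Y) ∧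
      anisoH ![Metric.closedBall A₁ r, Metric.closedBall A₂ r] (B ∩ C) X Y =
        formOfMatrix b
          ((-(r * Real.cos α)) •
            !![1 / 2 * (α - Real.sin (2 * α) / 2) * (β + Real.sin (2 * β) / 2),
                (α - Real.sin (2 * α) / 2) * ((1 - Real.cos (2 * β)) / 4), 0;
              (α - Real.sin (2 * α) / 2) * ((1 - Real.cos (2 * β)) / 4),
                1 / 2 * (α - Real.sin (2 * α) / 2) * (β - Real.sin (2 * β) / 2), 0;
              0, 0, β * (α + Real.sin (2 * α) / 2)]) X Y) ∧
    (∀ X Y : Space,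
      UnionNormalCycleConverges ![Metric.closedBall A₁ r, Metric.closedBall A₂ r] (B ∩ C)
        (omegaTildeForm X Y) ∧
      anisoHTilde ![Metric.closedBall A₁ r, Metric.closedBall A₂ r] (B ∩ C) X Y =
        formOfMatrix b
          ((-(r * α * Real.cos α)) •
            !![β - Real.sin (2 * β) / 2, (Real.cos (2 * β) - 1) / 2, 0;
              (Real.cos (2 * β) - 1) / 2, β + Real.sin (2 * β) / 2, 0;
              0, 0, 0]) X Y) := by
  have hpi := Real.pi_pos
  have hd0 : 0 < dist A₁ A₂ / (2 * r) := div_pos (dist_pos.2 hne) (by positivity)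
  have hd1 : dist A₁ A₂ / (2 * r) < 1 := by
    rw [div_lt_one (by positivity)]
    exact hint
  have hαI : α ∈ Set.Ioo 0 (Real.pi / 2) := by
    rw [hα]
    exact ⟨Real.arcsin_pos.2 hd0, Real.arcsin_lt_pi_div_two.2 hd1⟩
  have hρ : 0 < r * Real.cos α :=
    mul_pos hr (Real.cos_pos_of_mem_Ioo ⟨by linarith [hαI.1], hαI.2⟩)
  -- The given frame may be left-handed, while the orientation computations need a direct one.
  -- Reversing the third vector changes neither the swept arc nor the two forms.
  obtain ⟨b', hb', h0, h1, h2⟩ := exists_isRightHanded b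
  have hcent := centers_eq (b := b') hr hint hα (h0 ▸ hi) (h1 ▸ hj)
  set O := midpoint ℝ A₁ A₂ with hO
  have hCeq : C = Metric.sphere (O - (r * Real.sin α) • b' 2) r ∩
      Metric.sphere (O + (r * Real.sin α) • b' 2) r := by
    rw [hC]
    rcases hcent with ⟨e1, e2⟩ | ⟨e1, e2⟩
    · rw [← e1, ← e2]
    · rw [← e1, ← e2, Set.inter_comm]
  have hlens : Metric.closedBall A₁ r ∩ Metric.closedBall A₂ r = lens b' O r α := by
    rw [lens]
    rcases hcent with ⟨e1, e2⟩ | ⟨e1, e2⟩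
    · rw [← e1, ← e2]
    · rw [← e1, ← e2, Set.inter_comm]
  obtain ⟨himg, hrange⟩ := sphere_inter_sphere_eq_range (b := b') (O := O) hr hαI
  rw [← hCeq] at himg hrange
  have hBC : MeasurableSet (B ∩ C) := by
    refine MeasurableSet.inter ?_ ?_
    · obtain ⟨c, s, hB | hB⟩ := hB
      · rw [hB]
        exact Metric.isClosed_closedBall.measurableSet
      · rw [hB]
        exact Metric.isOpen_ball.measurableSet
    · rw [hC]
      exact (Metric.isClosed_sphere.inter Metric.isClosed_sphere).measurableSet
  have harc' : ∀ u ∈ Set.Ioo 0 β, circlePoint b' O (r * Real.cos α) u ∈ B ∩ C := by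
    intro u hu
    rw [circlePoint, radial, h0, h1]
    exact harc u hu
  obtain ⟨hβ0, hT⟩ := circleParam_ae_eq hρ hBC hβ harc' himg
  have hsub : B ∩ C ⊆ Metric.sphere (O - (r * Real.sin α) • b' 2) r ∩
      Metric.sphere (O + (r * Real.sin α) • b' 2) r := hCeq ▸ Set.inter_subset_right
  have hsub' : B ∩ C ⊆ Set.range (circlePoint b' O (r * Real.cos α)) :=
    hrange ▸ Set.inter_subset_right
  refine ⟨fun X Y => ?_, fun X Y => ?_⟩
  · rw [← formOfMatrix_congr h0 h1 h2]
    exact unionNormalCycle_closedBalls hr rfl rfl hsub' hlens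
      (convexNormalCycle_lens_omegaForm hb' hr hαI hBC hsub hβ0 hT X Y)
  · rw [← formOfMatrix_congr h0 h1 h2]
    exact unionNormalCycle_closedBalls hr rfl rfl hsub' hlens
      (convexNormalCycle_lens_omegaTildeForm hb' hr hαI hBC hsub hβ0 hT X Y)
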